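/- All graphs are finite and simple. A split of a graph is a partition $(A,B)$ of its vertex set with $|A|,|B|\ge 2$ such that for some $A'\subseteq A$ and $B'\subseteq B$, vertices $x\in A$ and $y\in B$ are adjacent if and only if $x\in A'$ and $y\in B'$. A graph is prime if it has no split. For a vertex $v$ of a graph $G$, let $G\setminus v$ be the graph obtained by deleting $v$, and let $G*v$ (local complementation at $v$) be the graph obtained from $G$ by complementing the adjacency between every pair of distinct neighbors of $v$. Two graphs are locally equivalent if one is obtained from the other by a sequence of local complementations; a graph $G$ is locally equivalent to a cycle graph if it is locally equivalent to some graph isomorphic to a cycle $C_k$ with $k\ge 3$. For an edge $vw$ let $G\wedge vw=G*v*w*v$. Let $G/v$ denote $G\setminus v$ if $v$ has no neighbor, and otherwise $(G\wedge vw)\setminus v$ for an arbitrary neighbor $w$ of $v$ (different choices of $w$ give locally equivalent graphs, and locally equivalent graphs are either all prime or all non-prime). A vertex $v$ of $G$ is non-essential if at least two of $G\setminus v$, $(G*v)\setminus v$ and $G/v$ are prime. **Theorem.** Every prime graph with at least $5$ vertices that is not locally equivalent to a cycle graph has at least $2$ non-essential vertices. -/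

import Mathlib

namespace SimpleGraph

variable {V : Type*}

/-- `G * v`: the edge set of `G` is changed by symmetric difference with the set of all pairs of
distinct neighbours of `v`. -/
def localComplement (G : SimpleGraph V) (v : V) : SimpleGraph V where
  Adj x y := Xor (G.Adj x y) (x ≠ y ∧ G.Adj v x ∧ G.Adj v y)
  symm := ⟨fun x y h => by
    rw [G.adj_comm y x, ne_comm, and_comm (a := G.Adj v y)]
    exact h⟩
  loopless := ⟨fun x h => by simp [Xor] at h⟩

/-- Two graphs on the same vertex set are locally equivalent if the second is obtained from the
first by a finite (possibly empty) sequence of local complementations. -/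
def LocallyEquivalent (G H : SimpleGraph V) : Prop :=
  Relation.ReflTransGen (fun K L : SimpleGraph V => ∃ v, L = K.localComplement v) G H

/-- `G ∧ vw = G * v * w * v` (used for edges `vw` of `G`). -/
def pivot (G : SimpleGraph V) (v w : V) : SimpleGraph V :=
  ((G.localComplement v).localComplement w).localComplement v

/-- `G \ v`: deletion of the vertex `v`. -/
def deleteVertex (G : SimpleGraph V) (v : V) : SimpleGraph ↥({v}ᶜ : Set V) :=
  G.induce {v}ᶜ

/-- `(A, B)` is a split of `G`: a partition of the vertex set, both parts having at least two
elements, such that the edges between `A` and `B` are exactly the pairs in `A' × B'` for some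
`A' ⊆ A` and `B' ⊆ B`. -/
def IsSplit (G : SimpleGraph V) (A B : Set V) : Prop :=
  Disjoint A B ∧ A ∪ B = Set.univ ∧ A.Nontrivial ∧ B.Nontrivial ∧
    ∃ A' ⊆ A, ∃ B' ⊆ B, ∀ x ∈ A, ∀ y ∈ B, (G.Adj x y ↔ x ∈ A' ∧ y ∈ B')

/-- A graph is prime if it has no split. -/
def IsPrime (G : SimpleGraph V) : Prop :=
  ∀ A B : Set V, ¬ G.IsSplit A B

/-- `H` is a value of `G / v`: `G / v` is `G \ v` if `v` has no neighbour, and otherwise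
`(G ∧ vw) \ v` for an arbitrary neighbour `w` of `v`. -/
def IsContraction (G : SimpleGraph V) (v : V) (H : SimpleGraph ↥({v}ᶜ : Set V)) : Prop :=
  ((∀ w, ¬ G.Adj v w) ∧ H = G.deleteVertex v) ∨
    ∃ w, G.Adj v w ∧ H = (G.pivot v w).deleteVertex v

/-- `G / v` is prime, whichever neighbour of `v` is used to form it. -/
def PrimeContraction (G : SimpleGraph V) (v : V) : Prop :=
  ∀ H, G.IsContraction v H → H.IsPrime

/-- At least two of `G \ v`, `(G * v) \ v` and `G / v` are prime. -/
def IsNonEssential (G : SimpleGraph V) (v : V) : Prop :=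
  ((G.deleteVertex v).IsPrime ∧ ((G.localComplement v).deleteVertex v).IsPrime) ∨
  ((G.deleteVertex v).IsPrime ∧ G.PrimeContraction v) ∨
  (((G.localComplement v).deleteVertex v).IsPrime ∧ G.PrimeContraction v)

/-- `G` is locally equivalent to a cycle graph, that is, to a graph on the vertex set of `G`
which is isomorphic to the cycle of length `k` for some `k ≥ 3`. -/
def LocallyEquivalentToCycle (G : SimpleGraph V) : Prop :=
  ∃ H : SimpleGraph V, G.LocallyEquivalent H ∧ ∃ k ≥ 3, Nonempty (H ≃g cycleGraph k)

end SimpleGraph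

/-! The graph is replaced by an isotropic system in the sense of Bouchet: the Lagrangian subspace L
of (F_2^2)^V spanned by the vectors `row G a b v`. Local complementation leaves L fixed and only
renames the nonzero vectors (types) at the vertices (`Presents.localComplement`). The three minors
at v correspond to the three types at v. The function |X| - dim L_X is the cut-rank, so primeness
says that it is at least 2 on every set with two or more vertices on each side.

The argument then runs as in Tutte's wheel theorem. If at most one vertex is non-essential, then of
any two vertices one is blocked in two types (`TwoBlocked`). Uncrossing the two separations by
submodularity puts such a vertex in a triple, a member of L with exactly three vertices in its
support (`Prime.exists_isTriple_of_blocked`); an analogue of Tutte's triangle lemma produces further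
triples (`Prime.exists_adjacent_triple`). Triples overlap rigidly: they agree at a single common
vertex and differ when exactly two are common. This rigidity lets a chain of consecutive triples
grow until it spans V (`IsChain.exists_succ`).

Connectivity is invariant under complements, so a spanning chain closes up cyclically. With the type
at each vertex taken to be the common value of the two triples that end there, the triples become
the rows of a graph locally equivalent to G, and that graph is a cycle
(`Presents.locallyEquivalentToCycle`). -/

set_option linter.unusedSectionVars false

open Module

/-- The two-dimensional space over the field with two elements. -/
abbrev Pauli := ZMod 2 × ZMod 2

/-! ### The symplectic plane over the field with two elements -/

namespace Pauli

/-- The symplectic form. -/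
def symp (a b : Pauli) : ZMod 2 := a.1 * b.2 + a.2 * b.1

lemma symp_comm : ∀ a b : Pauli, symp a b = symp b a := by decide
lemma symp_self : ∀ a : Pauli, symp a a = 0 := by decide
lemma symp_zero_left : ∀ a : Pauli, symp 0 a = 0 := by decide
lemma symp_zero_right : ∀ a : Pauli, symp a 0 = 0 := by decide
lemma symp_add_left : ∀ a b c : Pauli, symp (a + b) c = symp a c + symp b c := by decide
lemma symp_add_right : ∀ a b c : Pauli, symp a (b + c) = symp a b + symp a c := by decide
lemma symp_smul_left : ∀ (r : ZMod 2) (a b : Pauli), symp (r • a) b = r * symp a b := by decide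
lemma symp_smul_right : ∀ (r : ZMod 2) (a b : Pauli), symp a (r • b) = r * symp a b := by decide
lemma eq_zero_or_eq_of_symp : ∀ a b : Pauli, b ≠ 0 → symp a b = 0 → a = 0 ∨ a = b := by decide
lemma eq_of_symp : ∀ a b : Pauli, a ≠ 0 → b ≠ 0 → symp a b = 0 → a = b := by decide
lemma symp_eq_one : ∀ a b : Pauli, a ≠ 0 → b ≠ 0 → a ≠ b → symp a b = 1 := by decide
lemma eq_zero_of_forall_symp : ∀ a : Pauli, (∀ b, symp a b = 0) → a = 0 := by decide
lemma add_self : ∀ a : Pauli, a + a = 0 := by decide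
lemma add_eq_zero : ∀ a b : Pauli, a + b = 0 ↔ a = b := by decide

end Pauli

/-! ### Symplectic spaces and Lagrangian subspaces -/

open Pauli

/-- The sum of the symplectic forms of the coordinates. -/
def sympForm (V : Type*) [Fintype V] : LinearMap.BilinForm (ZMod 2) (V → Pauli) :=
  LinearMap.mk₂ (ZMod 2) (fun x y => ∑ v, symp (x v) (y v))
    (fun x y z => by simp [symp_add_left, Finset.sum_add_distrib])
    (fun r x y => by simp only [Pi.smul_apply, symp_smul_left, Finset.mul_sum, smul_eq_mul])
    (fun x y z => by simp [symp_add_right, Finset.sum_add_distrib])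
    (fun r x y => by simp only [Pi.smul_apply, symp_smul_right, Finset.mul_sum, smul_eq_mul])

section Form

variable {V : Type*} [Fintype V]

lemma sympForm_apply (x y : V → Pauli) : sympForm V x y = ∑ v, symp (x v) (y v) := rfl

lemma sympForm_isRefl : (sympForm V).IsRefl := fun x y h => by
  rw [sympForm_apply] at h ⊢
  simpa only [symp_comm] using h

lemma sympForm_nondegenerate : (sympForm V).Nondegenerate := by
  classical
  have key : ∀ x : V → Pauli, (∀ y, sympForm V x y = 0) → x = 0 := by
    intro x h
    funext v
    refine eq_zero_of_forall_symp _ fun b => ?_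
    have := h (Pi.single v b)
    rw [sympForm_apply, Finset.sum_eq_single v] at this
    · simpa using this
    · intro w _ hw
      simp [Pi.single_eq_of_ne hw, symp_zero_right]
    · simp
  refine ⟨key, fun y h => key y fun x => sympForm_isRefl _ _ (h x)⟩

end Form

/-- The vectors whose support is contained in `X`. -/
def vanishingOff (M : Type*) [AddCommGroup M] [Module (ZMod 2) M] {V : Type*} (X : Finset V) :
    Submodule (ZMod 2) (V → M) where
  carrier := {x | ∀ v ∉ X, x v = 0}
  add_mem' hx hy v hv := by simp [hx v hv, hy v hv]
  zero_mem' v _ := rfl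
  smul_mem' r x hx v hv := by simp [hx v hv]

/-- A Lagrangian subspace of the space of vectors over `Pauli` indexed by `V`. -/
structure IsotropicSystem (V : Type*) [Fintype V] where
  carrier : Submodule (ZMod 2) (V → Pauli)
  isotropic : ∀ x ∈ carrier, ∀ y ∈ carrier, ∑ v, symp (x v) (y v) = 0
  finrank_eq : finrank (ZMod 2) carrier = Fintype.card V

section VanishingOff
variable {V : Type*}

lemma finrank_vanishingOff (M : Type*) [AddCommGroup M] [Module (ZMod 2) M]
    [Module.Finite (ZMod 2) M] [DecidableEq V] (X : Finset V) :
    finrank (ZMod 2) (vanishingOff M X) = X.card * finrank (ZMod 2) M := by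
  let e : vanishingOff M X ≃ₗ[ZMod 2] (X → M) :=
    { toFun := fun x v => x.1 v
      map_add' := fun _ _ => rfl
      map_smul' := fun _ _ => rfl
      invFun := fun f => ⟨fun v => if h : v ∈ X then f ⟨v, h⟩ else 0,
        fun v hv => by simp [hv]⟩
      left_inv := fun x => by
        ext v
        by_cases h : v ∈ X
        · simp [h]
        · simp [h, x.2 v h]
      right_inv := fun f => by
        funext v
        simp }
  rw [e.finrank_eq, Module.finrank_pi_fintype]
  simp

/-- Evaluation at `u` maps `S` into the line spanned by `b`, and its kernel lies in `S'`. -/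
lemma finrank_le_add_one [Fintype V] {S S' : Submodule (ZMod 2) (V → Pauli)} (u : V) (b : Pauli)
    (h1 : ∀ x ∈ S, x u = 0 ∨ x u = b) (h2 : ∀ x ∈ S, x u = 0 → x ∈ S') :
    finrank (ZMod 2) S ≤ finrank (ZMod 2) S' + 1 := by
  let f : S →ₗ[ZMod 2] Pauli := (LinearMap.proj u).comp S.subtype
  have hr := f.finrank_range_add_finrank_ker
  have h3 : finrank (ZMod 2) (LinearMap.range f) ≤ 1 := by
    refine (Submodule.finrank_mono (t := Submodule.span (ZMod 2) {b}) ?_).trans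
      ((finrank_span_le_card _).trans (by simp))
    rintro _ ⟨x, rfl⟩
    rcases h1 x.1 x.2 with h | h
    · change x.1 u ∈ _
      rw [h]; exact Submodule.zero_mem _
    · change x.1 u ∈ _
      rw [h]; exact Submodule.mem_span_singleton_self b
  have h4 : finrank (ZMod 2) (LinearMap.ker f) ≤ finrank (ZMod 2) S' := by
    rw [← Submodule.finrank_map_subtype_eq S (LinearMap.ker f)]
    refine Submodule.finrank_mono ?_
    rintro _ ⟨x, hx, rfl⟩
    exact h2 x.1 x.2 hx
  omega

end VanishingOff

/-! ### The connectivity function and primeness -/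

namespace IsotropicSystem

variable {V : Type*} [Fintype V] (L : IsotropicSystem V)

/-- The members of `L` whose support is contained in `X`. -/
def supported (X : Finset V) : Submodule (ZMod 2) (V → Pauli) := L.carrier ⊓ vanishingOff Pauli X

/-- The connectivity function. -/
noncomputable def conn (X : Finset V) : ℤ := X.card - finrank (ZMod 2) (L.supported X)

variable {L}

lemma mem_supported {X : Finset V} {x : V → Pauli} :
    x ∈ L.supported X ↔ x ∈ L.carrier ∧ ∀ v ∉ X, x v = 0 := Iff.rfl

lemma supported_mono {X Y : Finset V} (h : X ⊆ Y) : L.supported X ≤ L.supported Y :=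
  fun _ hx => ⟨hx.1, fun v hv => hx.2 v fun h' => hv (h h')⟩

lemma symp_of_overlap {x y : V → Pauli} (hx : x ∈ L.carrier) (hy : y ∈ L.carrier) {v : V}
    (h : ∀ w, w ≠ v → x w = 0 ∨ y w = 0) : symp (x v) (y v) = 0 := by
  classical
  have := L.isotropic x hx y hy
  rwa [Finset.sum_eq_single v] at this
  · intro w _ hw
    rcases h w hw with h | h <;> simp [h, symp_zero_left, symp_zero_right]
  · simp

lemma symp_of_overlap_pair {x y : V → Pauli} (hx : x ∈ L.carrier) (hy : y ∈ L.carrier) {u v : V}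
    (huv : u ≠ v) (h : ∀ w, w ≠ u → w ≠ v → x w = 0 ∨ y w = 0) :
    symp (x u) (y u) + symp (x v) (y v) = 0 := by
  classical
  have := L.isotropic x hx y hy
  rwa [← Finset.sum_subset (Finset.subset_univ {u, v}), Finset.sum_pair huv] at this
  intro w _ hw
  simp only [Finset.mem_insert, Finset.mem_singleton, not_or] at hw
  rcases h w hw.1 hw.2 with h | h <;> simp [h, symp_zero_left, symp_zero_right]

/-- Only the term at `v` survives in the isotropy relation, and in the plane a vector orthogonal to
`y v ≠ 0` is 0 or `y v`. This is the main source of restrictions on values below. -/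
lemma eq_zero_or_eq {x y : V → Pauli} (hx : x ∈ L.carrier) (hy : y ∈ L.carrier) {v : V}
    (hv : y v ≠ 0) (h : ∀ w, w ≠ v → x w = 0 ∨ y w = 0) : x v = 0 ∨ x v = y v :=
  eq_zero_or_eq_of_symp _ _ hv (symp_of_overlap hx hy h)

lemma conn_le_card (X : Finset V) : L.conn X ≤ X.card := by
  unfold conn; omega

variable [DecidableEq V]

/-- The dimension formula for L_X and L_Y: their sum lies in L_(X ∪ Y) and their intersection in
L_(X ∩ Y). -/
lemma conn_submodular (X Y : Finset V) :
    L.conn (X ∩ Y) + L.conn (X ∪ Y) ≤ L.conn X + L.conn Y := by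
  have h1 := Submodule.finrank_sup_add_finrank_inf_eq (L.supported X) (L.supported Y)
  have h2 : finrank (ZMod 2) ↥(L.supported X ⊔ L.supported Y) ≤
      finrank (ZMod 2) (L.supported (X ∪ Y)) :=
    Submodule.finrank_mono (sup_le (supported_mono Finset.subset_union_left)
      (supported_mono Finset.subset_union_right))
  have h3 : finrank (ZMod 2) ↥(L.supported X ⊓ L.supported Y) ≤
      finrank (ZMod 2) (L.supported (X ∩ Y)) := by
    refine Submodule.finrank_mono fun x hx => ⟨hx.1.1, fun v hv => ?_⟩
    by_cases h : v ∈ X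
    · exact hx.2.2 v fun h' => hv (Finset.mem_inter.2 ⟨h, h'⟩)
    · exact hx.1.2 v h
  have h4 := Finset.card_union_add_card_inter X Y
  unfold conn
  omega

/-- L and all vectors supported off `X` are orthogonal to L_X. Nondegeneracy bounds the dimension of
their sum, which bounds that of their intersection L_(Xᶜ) from below. -/
lemma conn_compl_le (X : Finset V) : L.conn Xᶜ ≤ L.conn X := by
  have h1 := Submodule.finrank_sup_add_finrank_inf_eq L.carrier (vanishingOff Pauli Xᶜ)
  have h2 : L.carrier ⊔ vanishingOff Pauli Xᶜ ≤ (sympForm V).orthogonal (L.supported X) := by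
    refine sup_le (fun x hx y hy => ?_) (fun x hx y hy => ?_)
    · exact L.isotropic y hy.1 x hx
    · change sympForm V y x = 0
      rw [sympForm_apply]
      refine Finset.sum_eq_zero fun v _ => ?_
      by_cases h : v ∈ X
      · rw [hx v (by simpa using h), symp_zero_right]
      · rw [hy.2 v h, symp_zero_left]
  have h3 := Submodule.finrank_mono h2
  rw [LinearMap.BilinForm.finrank_orthogonal sympForm_nondegenerate] at h3
  rw [finrank_vanishingOff, L.finrank_eq] at h1
  have h7 : finrank (ZMod 2) Pauli = 2 := by simp
  rw [h7] at h1
  have h4 : finrank (ZMod 2) (V → Pauli) = 2 * Fintype.card V := by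
    rw [Module.finrank_pi_fintype]; simp [mul_comm]
  have h5 : finrank (ZMod 2) (L.supported X) ≤ finrank (ZMod 2) (V → Pauli) :=
    Submodule.finrank_le _
  have h6 := X.card_add_card_compl
  change _ + finrank (ZMod 2) (L.supported Xᶜ) = _ at h1
  unfold conn
  omega

lemma conn_compl (X : Finset V) : L.conn Xᶜ = L.conn X :=
  le_antisymm (conn_compl_le X) (by simpa using conn_compl_le (L := L) Xᶜ)

/-- Adding `v` changes the connectivity by 1 - d, where d is the dimension of the space of values at
`v` of members supported on `insert v X`. Here d ≥ 1; the next two lemmas treat d = 2 and d = 0. -/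
lemma conn_insert_le {X : Finset V} {v : V} (hv : v ∉ X) {x : V → Pauli}
    (hx : x ∈ L.supported (insert v X)) (hxv : x v ≠ 0) : L.conn (insert v X) ≤ L.conn X := by
  have : L.supported X < L.supported (insert v X) :=
    lt_of_le_of_ne (supported_mono (Finset.subset_insert v X))
      fun h => hxv ((h ▸ hx : x ∈ L.supported X).2 v hv)
  have := Submodule.finrank_lt_finrank_of_lt this
  unfold conn
  rw [Finset.card_insert_of_notMem hv]
  push_cast
  omega

lemma conn_insert_lt {X : Finset V} {v : V} (hv : v ∉ X) {x y : V → Pauli}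
    (hx : x ∈ L.supported (insert v X)) (hxv : x v ≠ 0)
    (hy : y ∈ L.supported (insert v X)) (hyv : y v ≠ 0) (hxy : x v ≠ y v) :
    L.conn (insert v X) < L.conn X := by
  have hle := supported_mono (L := L) (Finset.subset_insert v X)
  have h1 : L.supported X < L.supported X ⊔ Submodule.span (ZMod 2) {x} :=
    lt_of_le_of_ne le_sup_left fun h => hxv (((h.symm ▸ Submodule.mem_sup_right
      (Submodule.mem_span_singleton_self x) : x ∈ L.supported X)).2 v hv)
  have h2 : L.supported X ⊔ Submodule.span (ZMod 2) {x} < L.supported (insert v X) := by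
    refine lt_of_le_of_ne (sup_le hle (by simpa using hx)) fun h => ?_
    have hy' : y ∈ L.supported X ⊔ Submodule.span (ZMod 2) {x} := h ▸ hy
    obtain ⟨z, hz, w, hw, rfl⟩ := Submodule.mem_sup.1 hy'
    obtain ⟨r, rfl⟩ := Submodule.mem_span_singleton.1 hw
    have hr : ∀ r : ZMod 2, r = 0 ∨ r = 1 := by decide
    rcases hr r with rfl | rfl
    · simp [hz.2 v hv] at hyv
    · simp [hz.2 v hv] at hxy
  have h1 := Submodule.finrank_lt_finrank_of_lt h1
  have h2 := Submodule.finrank_lt_finrank_of_lt h2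
  unfold conn
  rw [Finset.card_insert_of_notMem hv]
  push_cast
  omega

lemma conn_insert_of_forall {X : Finset V} {v : V} (hv : v ∉ X)
    (h : ∀ x ∈ L.supported (insert v X), x v = 0) : L.conn (insert v X) = L.conn X + 1 := by
  have : L.supported (insert v X) = L.supported X := by
    refine le_antisymm (fun x hx => ⟨hx.1, fun w hw => ?_⟩)
      (supported_mono (Finset.subset_insert v X))
    by_cases hwv : w = v
    · rw [hwv]; exact h x hx
    · exact hx.2 w (by simp [hw, hwv])
  unfold conn
  rw [this, Finset.card_insert_of_notMem hv]
  push_cast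
  ring

variable (L) in
/-- Every set of connectivity at most one is trivial. -/
def Prime : Prop := ∀ X : Finset V, 2 ≤ X.card → X.card + 2 ≤ Fintype.card V → 2 ≤ L.conn X

/-- In a prime system there is no nonzero vector supported by at most two elements. -/
lemma Prime.eq_zero_of_pair (hL : L.Prime) (hn : 4 ≤ Fintype.card V) {x : V → Pauli}
    (hx : x ∈ L.carrier) (u v : V) (h : ∀ w, w ≠ u → w ≠ v → x w = 0) : x = 0 := by
  by_contra hne
  obtain ⟨X, hX, hXc⟩ : ∃ X : Finset V, {u, v} ⊆ X ∧ X.card = 2 :=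
    Finset.exists_superset_card_eq Finset.card_le_two (by omega)
  have h1 : 2 ≤ L.conn X := hL X hXc.ge (by omega)
  have h2 : x ∈ L.supported X := ⟨hx, fun w hw => h w (fun e => hw (hX (by simp [e])))
    (fun e => hw (hX (by simp [e])))⟩
  have h3 : 0 < finrank (ZMod 2) (L.supported X) := by
    rw [Module.finrank_pos_iff]
    exact ⟨⟨x, h2⟩, 0, fun e => hne (congrArg Subtype.val e)⟩
  unfold conn at h1
  omega

lemma exists_ne_zero_of_conn_lt {X : Finset V} (h : L.conn X < X.card) :
    ∃ x ∈ L.supported X, x ≠ 0 := by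
  have : 0 < finrank (ZMod 2) (L.supported X) := by unfold conn at h; omega
  rw [Module.finrank_pos_iff] at this
  obtain ⟨x, hx⟩ := exists_ne (0 : L.supported X)
  exact ⟨x.1, x.2, fun e => hx (Subtype.ext e)⟩

end IsotropicSystem

/-! ### Triples, separations and uncrossing -/

namespace IsotropicSystem

variable {V : Type*} [Fintype V] {L : IsotropicSystem V}

variable (L) in
/-- `t` is a member of `L` whose support consists of the three vertices `u`, `v`, `w`. -/
structure IsTriple (t : V → Pauli) (u v w : V) : Prop where
  mem : t ∈ L.carrier
  ne_fst : u ≠ v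
  ne_mid : u ≠ w
  ne_lst : v ≠ w
  fst : t u ≠ 0
  mid : t v ≠ 0
  lst : t w ≠ 0
  zero : ∀ x, x ≠ u → x ≠ v → x ≠ w → t x = 0

namespace IsTriple

variable {t s : V → Pauli} {u v w x y : V}

lemma swap_left (h : L.IsTriple t u v w) : L.IsTriple t v u w :=
  ⟨h.mem, h.ne_fst.symm, h.ne_lst, h.ne_mid, h.mid, h.fst, h.lst, fun x h1 h2 => h.zero x h2 h1⟩

lemma swap_right (h : L.IsTriple t u v w) : L.IsTriple t u w v :=
  ⟨h.mem, h.ne_mid, h.ne_fst, h.ne_lst.symm, h.fst, h.lst, h.mid,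
    fun x h1 h2 h3 => h.zero x h1 h3 h2⟩

lemma rotate (h : L.IsTriple t u v w) : L.IsTriple t v w u := h.swap_left.swap_right

lemma reverse (h : L.IsTriple t u v w) : L.IsTriple t w v u := h.swap_right.rotate

/-- Triples meeting in a single vertex agree there. -/
lemma agree (h : L.IsTriple t u v w) (h' : L.IsTriple s u x y) (h1 : v ≠ x) (h2 : v ≠ y)
    (h3 : w ≠ x) (h4 : w ≠ y) : t u = s u := by
  refine eq_of_symp _ _ h.fst h'.fst (symp_of_overlap h.mem h'.mem fun z hz => ?_)
  by_cases hv : z = v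
  · exact Or.inr (h'.zero z hz (hv ▸ h1) (hv ▸ h2))
  by_cases hw : z = w
  · exact Or.inr (h'.zero z hz (hw ▸ h3) (hw ▸ h4))
  · exact Or.inl (h.zero z hz hv hw)

end IsTriple

variable [DecidableEq V]

lemma Prime.two_le_conn (hL : L.Prime) {X : Finset V} (h : 2 ≤ X.card) {a b : V} (hab : a ≠ b)
    (ha : a ∉ X) (hb : b ∉ X) : 2 ≤ L.conn X := by
  refine hL X h ?_
  have := Finset.card_le_univ (insert a (insert b X))
  rwa [Finset.card_insert_of_notMem (by simp [hab, ha]), Finset.card_insert_of_notMem hb] at this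

lemma Prime.card_le_one (hL : L.Prime) {X : Finset V} (h : L.conn X ≤ 1) {a b : V} (hab : a ≠ b)
    (ha : a ∉ X) (hb : b ∉ X) : X.card ≤ 1 := by
  by_contra h'
  have := hL.two_le_conn (X := X) (by omega) hab ha hb
  omega

/-- Triples meeting in exactly two vertices differ there. -/
lemma IsTriple.differ {t s : V → Pauli} {u v w x : V} (hL : L.Prime) (hn : 4 ≤ Fintype.card V)
    (h : L.IsTriple t u v w) (h' : L.IsTriple s u v x) (hwx : w ≠ x) : t u ≠ s u := by
  intro he
  -- Equality at `u` forces equality at `v` by isotropy; then `t + s` is supported on `{w, x}`,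
  -- hence zero, although it equals `t w ≠ 0` at `w`.
  have h1 := symp_of_overlap_pair h.mem h'.mem h.ne_fst fun z hu hv => by
    by_cases hw : z = w
    · exact Or.inr (h'.zero z hu hv (hw ▸ hwx))
    · exact Or.inl (h.zero z hu hv hw)
  rw [he, symp_self, zero_add] at h1
  have h2 := eq_of_symp _ _ h.mid h'.mid h1
  have h3 := hL.eq_zero_of_pair hn (L.carrier.add_mem h.mem h'.mem) w x fun z hw hx => by
    by_cases hu : z = u
    · rw [hu, Pi.add_apply, he, add_self]
    by_cases hv : z = v
    · rw [hv, Pi.add_apply, h2, add_self]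
    simp [h.zero z hu hv hw, h'.zero z hu hv hx]
  have h4 := congrFun h3 w
  rw [Pi.add_apply, h'.zero w h.ne_mid.symm h.ne_lst.symm hwx, add_zero] at h4
  exact h.lst h4

lemma IsTriple.mem_supported {t : V → Pauli} {u v w : V} (h : L.IsTriple t u v w) {X : Finset V}
    (hu : u ∈ X) (hv : v ∈ X) (hw : w ∈ X) : t ∈ L.supported X :=
  ⟨h.mem, fun x hx => h.zero x (fun e => hx (e ▸ hu)) (fun e => hx (e ▸ hv))
    (fun e => hx (e ▸ hw))⟩

/-- Connectivity below the cardinality 3 yields a nonzero member, and primeness forbids a support of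
at most two vertices. -/
lemma Prime.exists_isTriple (hL : L.Prime) (hn : 4 ≤ Fintype.card V) {u v w : V} (huv : u ≠ v)
    (huw : u ≠ w) (hvw : v ≠ w) (h : L.conn {u, v, w} ≤ 2) : ∃ t, L.IsTriple t u v w := by
  have hc : ({u, v, w} : Finset V).card = 3 := Finset.card_eq_three.2 ⟨u, v, w, huv, huw, hvw, rfl⟩
  obtain ⟨t, ht, hne⟩ := exists_ne_zero_of_conn_lt (L := L) (X := {u, v, w}) (by rw [hc]; omega)
  have h0 : ∀ x, x ≠ u → x ≠ v → x ≠ w → t x = 0 := fun x h1 h2 h3 => ht.2 x (by simp [*])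
  refine ⟨t, ht.1, huv, huw, hvw, fun e => hne ?_, fun e => hne ?_, fun e => hne ?_, h0⟩
  · refine hL.eq_zero_of_pair hn ht.1 v w fun x h2 h3 => ?_
    by_cases h1 : x = u
    · rw [h1, e]
    · exact h0 x h1 h2 h3
  · refine hL.eq_zero_of_pair hn ht.1 u w fun x h1 h3 => ?_
    by_cases h2 : x = v
    · rw [h2, e]
    · exact h0 x h1 h2 h3
  · refine hL.eq_zero_of_pair hn ht.1 u v fun x h1 h2 => ?_
    by_cases h3 : x = w
    · rw [h3, e]
    · exact h0 x h1 h2 h3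

lemma IsTriple.conn_le {t : V → Pauli} {u v w : V} (h : L.IsTriple t u v w) :
    L.conn {u, v, w} ≤ 2 := by
  refine (conn_insert_le (v := u) (x := t) (by simp [h.ne_fst, h.ne_mid])
    (h.mem_supported (by simp) (by simp) (by simp)) h.fst).trans ((conn_le_card _).trans ?_)
  rw [Finset.card_pair h.ne_lst]; rfl

variable (L) in
/-- The parts `X`, `Y` of the other vertices certify that the minor at `v` of type `a`
is not prime. -/
structure Separation (v : V) (a : Pauli) (X Y : Finset V) : Prop where
  notMem_left : v ∉ X
  notMem_right : v ∉ Y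
  disjoint : ∀ w ∈ X, w ∉ Y
  cover : ∀ w, w = v ∨ w ∈ X ∨ w ∈ Y
  card_left : 2 ≤ X.card
  card_right : 2 ≤ Y.card
  conn_left : L.conn (insert v X) ≤ 2
  conn_right : L.conn (insert v Y) ≤ 2
  exists_left : ∃ x ∈ L.supported (insert v X), x v = a
  exists_right : ∃ y ∈ L.supported (insert v Y), y v = a

variable (L) in
/-- The minor at `v` of type `a` is not prime. -/
def Blocked (v : V) (a : Pauli) : Prop := ∃ X Y, L.Separation v a X Y

namespace Separation

variable {v : V} {a b : Pauli} {X Y X' Y' : Finset V}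

lemma symm (h : L.Separation v a X Y) : L.Separation v a Y X :=
  ⟨h.notMem_right, h.notMem_left, fun w hy hx => h.disjoint w hx hy,
    fun w => (h.cover w).imp_right Or.symm, h.card_right, h.card_left, h.conn_right, h.conn_left,
    h.exists_right, h.exists_left⟩

lemma compl_insert (h : L.Separation v a X Y) : (insert v Y)ᶜ = X := by
  ext w
  have h1 := h.disjoint w
  have h2 := h.cover w
  have h3 := h.notMem_left
  grind [Finset.mem_compl]

lemma conn_self (h : L.Separation v a X Y) : L.conn X ≤ 2 := by
  rw [← h.compl_insert, conn_compl]
  exact h.conn_right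

lemma eq_zero_or (h : L.Separation v a X Y) (ha : a ≠ 0) {p : V → Pauli} {S : Finset V}
    (hp : p ∈ L.supported S) (hS : ∀ w ∈ S, w ∉ Y) : p v = 0 ∨ p v = a := by
  obtain ⟨y, hy, rfl⟩ := h.exists_right
  refine eq_zero_or_eq hp.1 hy.1 ha fun w hw => ?_
  by_cases hwS : w ∈ S
  · exact Or.inr (hy.2 w (by simp [hw, hS w hwS]))
  · exact Or.inl (hp.2 w hwS)

/-- A member supported on `insert v (X ∩ X')` has value 0 or `a`, and also 0 or `b`, at `v`, hence
0; so `v` adds one to the connectivity of `X ∩ X'`. If both corners had two vertices, submodularity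
for `insert v X` and `insert v X'` would give 3 + 2 ≤ 2 + 2. -/
lemma card_inter_le (hL : L.Prime) (h : L.Separation v a X Y) (h' : L.Separation v b X' Y')
    (ha : a ≠ 0) (hb : b ≠ 0) (hab : a ≠ b) : (X ∩ X').card ≤ 1 ∨ (Y ∩ Y').card ≤ 1 := by
  by_contra! hlt
  have hc : (insert v X ∪ insert v X')ᶜ = Y ∩ Y' := by
    ext w
    have h1 := h.disjoint w
    have h2 := h.cover w
    have h3 := h'.disjoint w
    have h4 := h'.cover w
    have h5 := h.notMem_right
    grind [Finset.mem_compl]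
  have h1 := conn_submodular (L := L) (insert v X) (insert v X')
  rw [← conn_compl (insert v X ∪ insert v X'), hc, ← Finset.insert_inter_distrib,
    conn_insert_of_forall (by simp [h.notMem_left])] at h1
  · have h2 := h.conn_left
    have h3 := h'.conn_left
    obtain ⟨p, hp, q, hq, hpq⟩ := Finset.one_lt_card.1 (lt_of_lt_of_le one_lt_two hlt.2)
    obtain ⟨p', hp', q', hq', hpq'⟩ := Finset.one_lt_card.1 (lt_of_lt_of_le one_lt_two hlt.1)
    have h4 := hL.two_le_conn hlt.1 hpq (fun hm => h.disjoint p (Finset.mem_inter.1 hm).1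
      (Finset.mem_inter.1 hp).1) (fun hm => h.disjoint q (Finset.mem_inter.1 hm).1
      (Finset.mem_inter.1 hq).1)
    have h5 := hL.two_le_conn hlt.2 hpq' (fun hm => h.disjoint p' (Finset.mem_inter.1 hp').1
      (Finset.mem_inter.1 hm).1) (fun hm => h.disjoint q' (Finset.mem_inter.1 hq').1
      (Finset.mem_inter.1 hm).1)
    omega
  · intro p hp
    have hpa := h.eq_zero_or ha hp fun w hw => by
      rcases Finset.mem_insert.1 hw with rfl | hw
      · exact h.notMem_right
      · exact h.disjoint w (Finset.mem_inter.1 hw).1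
    have hpb := h'.eq_zero_or hb hp fun w hw => by
      rcases Finset.mem_insert.1 hw with rfl | hw
      · exact h'.notMem_right
      · exact h'.disjoint w (Finset.mem_inter.1 hw).2
    rcases hpa with e | e
    · exact e
    · rcases hpb with e' | e'
      · exact e'
      · exact absurd (e.symm.trans e') hab

lemma exists_isTriple (hL : L.Prime) (hn : 4 ≤ Fintype.card V) (h : L.Separation v a X Y)
    (hX : X.card ≤ 2) : ∃ t u w, L.IsTriple t v u w := by
  obtain ⟨u, w, huw, rfl⟩ := Finset.card_eq_two.1 (le_antisymm hX h.card_left)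
  have h1 := h.notMem_left
  simp only [Finset.mem_insert, Finset.mem_singleton, not_or] at h1
  obtain ⟨t, ht⟩ := hL.exists_isTriple hn h1.1 h1.2 huw h.conn_left
  exact ⟨t, u, w, ht⟩

lemma card_le_of_inter (h' : L.Separation v b X' Y') (h : v ∉ X) (h1 : (X ∩ X').card ≤ 1)
    (h2 : (X ∩ Y').card ≤ 1) : X.card ≤ 2 := by
  have : X ⊆ (X ∩ X') ∪ (X ∩ Y') := fun w hw => by
    rcases h'.cover w with rfl | hx | hx
    · exact absurd hw h
    · simp [hw, hx]
    · simp [hw, hx]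
  have h3 := Finset.card_le_card this
  have h4 := Finset.card_union_le (X ∩ X') (X ∩ Y')
  omega

/-- A triple and a separation of a different type at one of its vertices cross. -/
lemma cross (h : L.Separation v a X Y) (ha : a ≠ 0) {t : V → Pauli} {u w : V}
    (ht : L.IsTriple t v u w) (hat : t v ≠ a) : (u ∈ X ∧ w ∈ Y) ∨ (u ∈ Y ∧ w ∈ X) := by
  have key : ∀ {X Y : Finset V}, L.Separation v a X Y → u ∈ X → w ∈ X → False := by
    intro X Y h hu hw
    rcases h.eq_zero_or ha (S := insert v X) (ht.mem_supported (by simp) (by simp [hu])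
      (by simp [hw])) (fun x hx => by
        rcases Finset.mem_insert.1 hx with rfl | hx
        · exact h.notMem_right
        · exact h.disjoint x hx) with e | e
    · exact ht.fst e
    · exact hat e
  rcases (h.cover u).resolve_left ht.ne_fst.symm with hu | hu <;>
    rcases (h.cover w).resolve_left ht.ne_mid.symm with hw | hw
  · exact (key h hu hw).elim
  · exact Or.inl ⟨hu, hw⟩
  · exact Or.inr ⟨hu, hw⟩
  · exact (key h.symm hu hw).elim

end Separation

/-- A vertex with two blocked types lies in a triple. -/
lemma Prime.exists_isTriple_of_blocked (hL : L.Prime) (hn : 4 ≤ Fintype.card V) {v : V}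
    {a b : Pauli} (ha : a ≠ 0) (hb : b ≠ 0) (hab : a ≠ b) (hva : L.Blocked v a)
    (hvb : L.Blocked v b) : ∃ t u w, L.IsTriple t v u w := by
  obtain ⟨X, Y, h⟩ := hva
  obtain ⟨X', Y', h'⟩ := hvb
  -- Each pair of opposite corners has a corner with at most one vertex. Two such corners, one from
  -- each pair, together form one of the four sides, which then has two vertices.
  rcases h.card_inter_le hL h' ha hb hab with h1 | h1 <;>
    rcases h.card_inter_le hL h'.symm ha hb hab with h2 | h2
  · exact h.exists_isTriple hL hn (h'.card_le_of_inter h.notMem_left h1 h2)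
  · refine h'.exists_isTriple hL hn (h.card_le_of_inter h'.notMem_left ?_ ?_)
    · rwa [Finset.inter_comm]
    · rwa [Finset.inter_comm]
  · refine h'.symm.exists_isTriple hL hn (h.card_le_of_inter h'.notMem_right ?_ ?_)
    · rwa [Finset.inter_comm]
    · rwa [Finset.inter_comm]
  · exact h.symm.exists_isTriple hL hn (h'.card_le_of_inter h.notMem_right h2 h1)

/-- The separation consists of `{v, w}` and the complement of the triple. Without a member of value
`t u` on the large side, every value at `u` there would be 0, making the connectivity of `{v, w}`
one more than that of the triple, that is at least 3. -/
lemma IsTriple.blocked (hn : 5 ≤ Fintype.card V) {t : V → Pauli} {u v w : V}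
    (ht : L.IsTriple t u v w) (hL : L.Prime) : L.Blocked u (t u) := by
  have hc : ({u, v, w} : Finset V).card = 3 :=
    Finset.card_eq_three.2 ⟨u, v, w, ht.ne_fst, ht.ne_mid, ht.ne_lst, rfl⟩
  have hu : u ∉ ({v, w} : Finset V) := by simp [ht.ne_fst, ht.ne_mid]
  have hins : insert u ({u, v, w} : Finset V)ᶜ = ({v, w} : Finset V)ᶜ := by
    ext x; by_cases hx : x = u
    · subst hx; simp [ht.ne_fst, ht.ne_mid]
    · simp [hx]
  have hcY : 2 ≤ (({u, v, w} : Finset V)ᶜ).card := by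
    rw [Finset.card_compl, hc]; omega
  have hpair : L.conn {v, w} ≤ 2 := by
    refine (conn_le_card _).trans ?_
    rw [Finset.card_pair ht.ne_lst]; rfl
  have hcr : L.conn (insert u ({u, v, w} : Finset V)ᶜ) ≤ 2 := by
    rwa [hins, conn_compl]
  have hmem : t ∈ L.supported (insert u {v, w}) :=
    ht.mem_supported (by simp) (by simp) (by simp)
  refine ⟨{v, w}, ({u, v, w} : Finset V)ᶜ, hu, by simp, fun x hx => ?_, fun x => ?_,
    (Finset.card_pair ht.ne_lst).ge, hcY, ht.conn_le, hcr, ⟨t, hmem, rfl⟩, ?_⟩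
  · simp only [Finset.mem_insert, Finset.mem_singleton] at hx
    rcases hx with rfl | rfl <;> simp
  · by_cases h1 : x = u <;> by_cases h2 : x = v <;> by_cases h3 : x = w <;> simp [h1, h2, h3]
  · by_contra! hne
    have h0 : ∀ y ∈ L.supported (insert u ({u, v, w} : Finset V)ᶜ), y u = 0 := by
      intro y hy
      refine (eq_zero_or_eq hy.1 ht.mem ht.fst fun x hx => ?_).resolve_right (hne y hy)
      by_cases h : x = v ∨ x = w
      · exact Or.inl (hy.2 x (by rcases h with rfl | rfl <;> simp [hx]))
      · push Not at h
        exact Or.inr (ht.zero x hx h.1 h.2)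
    have h1 := conn_insert_of_forall (by simp) h0
    rw [hins, conn_compl, conn_compl] at h1
    obtain ⟨p, hp, q, hq, hpq⟩ := Finset.one_lt_card.1 (lt_of_lt_of_le one_lt_two hcY)
    have := hL.two_le_conn (X := {u, v, w}) (by omega) hpq (Finset.mem_compl.1 hp)
      (Finset.mem_compl.1 hq)
    omega

/-- If two vertices `u`, `v` of a triple are blocked in a type different from the type of the
triple, then `u` lies in another triple that contains exactly one of the remaining vertices. -/
lemma Prime.exists_adjacent_triple (hL : L.Prime) (hn : 4 ≤ Fintype.card V) {t : V → Pauli}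
    {u v w : V} (ht : L.IsTriple t u v w) {b c : Pauli} (hb0 : b ≠ 0) (hc0 : c ≠ 0)
    (htb : t u ≠ b) (htc : t v ≠ c) (hb : L.Blocked u b) (hc : L.Blocked v c) :
    ∃ s z, z ≠ u ∧ z ≠ v ∧ z ≠ w ∧ (L.IsTriple s u v z ∨ L.IsTriple s u w z) := by
  obtain ⟨X, Y, h, hvX, hwY⟩ : ∃ X Y, L.Separation u b X Y ∧ v ∈ X ∧ w ∈ Y := by
    obtain ⟨X, Y, h⟩ := hb
    rcases h.cross hb0 ht htb with h' | h'
    · exact ⟨X, Y, h, h'⟩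
    · exact ⟨Y, X, h.symm, h'⟩
  obtain ⟨Z, W, h', huZ, hwW⟩ : ∃ Z W, L.Separation v c Z W ∧ u ∈ Z ∧ w ∈ W := by
    obtain ⟨X, Y, h⟩ := hc
    rcases h.cross hc0 ht.swap_left htc with h' | h'
    · exact ⟨X, Y, h, h'⟩
    · exact ⟨Y, X, h.symm, h'⟩
  have huX := h.notMem_left
  have huY := h.notMem_right
  have hvZ := h'.notMem_left
  have hvW := h'.notMem_right
  have d1 := h.disjoint
  have d2 := h'.disjoint
  have c1 := h.cover
  have c2 := h'.cover
  have huv := ht.ne_fst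
  have huw := ht.ne_mid
  have hvw := ht.ne_lst
  have hwX : w ∉ X := fun e => d1 w e hwY
  have hwZ : w ∉ Z := fun e => d2 w e hwW
  have huW : u ∉ W := d2 u huZ
  have hvY : v ∉ Y := d1 v hvX
  -- the triple found in either of the two degenerate situations
  have key : X ∩ Z = ∅ ∨ (Y ∩ W).erase w = ∅ →
      (X ∩ W).Nonempty → (Y ∩ Z).Nonempty →
      ∃ s z, z ≠ u ∧ z ≠ v ∧ z ≠ w ∧ (L.IsTriple s u v z ∨ L.IsTriple s u w z) := by
    intro hcase hB hC
    have e1 : X ∩ insert v W = insert v (X ∩ W) := by grind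
    have e2 : (X ∪ insert v W)ᶜ = insert u (Y ∩ Z) := by
      ext x
      have := c1 x; have := c2 x; have := d1 x; have := d2 x
      grind [Finset.mem_compl]
    -- Both uncrossed sets have connectivity at least 2 and the bounds sum to 4, so both have
    -- connectivity exactly 2. In either case one of them loses connectivity when its added vertex
    -- is removed, so the corner left is a single vertex `z`.
    have h1 := conn_submodular (L := L) X (insert v W)
    rw [← conn_compl (X ∪ insert v W), e1, e2] at h1
    have h2 := h.conn_self
    have h3 := h'.conn_right
    have hvB : v ∉ X ∩ W := by simp [hvW]
    have huC : u ∉ Y ∩ Z := by simp [huY]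
    have h4 : 2 ≤ L.conn (insert v (X ∩ W)) := by
      refine hL.two_le_conn ?_ huw (by simp [huv, huX]) (by simp [hvw.symm, hwX])
      rw [Finset.card_insert_of_notMem hvB]
      have := hB.card_pos
      omega
    have h5 : 2 ≤ L.conn (insert u (Y ∩ Z)) := by
      refine hL.two_le_conn ?_ hvw (by simp [huv.symm, hvY]) (by simp [huw.symm, hwZ])
      rw [Finset.card_insert_of_notMem huC]
      have := hC.card_pos
      omega
    rcases hcase with hA | hD
    -- The value of `p` at `v` is 0 or `t v` because `p` meets `t` at most in `v`, and 0 or `c` by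
    -- the separation at `v`; these types differ.
    · have h6 := conn_insert_of_forall (L := L) hvB fun p hp => by
        have i1 : p v = 0 ∨ p v = t v := by
          refine eq_zero_or_eq hp.1 ht.mem ht.mid fun x hx => ?_
          by_cases hxu : x = u
          · exact Or.inl (hp.2 x (by simp [hxu, huv, huX]))
          by_cases hxw : x = w
          · exact Or.inl (hp.2 x (by simp [hxw, hvw.symm, hwX]))
          exact Or.inr (ht.zero x hxu hx hxw)
        have i2 := h'.symm.eq_zero_or hc0 hp fun x hx => by
          rcases Finset.mem_insert.1 hx with rfl | hx
          · exact hvZ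
          · exact fun e => d2 x e (Finset.mem_inter.1 hx).2
        rcases i1 with e | e
        · exact e
        rcases i2 with e' | e'
        · exact e'
        · exact absurd (e.symm.trans e') htc
      have h7 := hL.card_le_one (X := X ∩ W) (by omega) huw (by simp [huX]) (by simp [hwX])
      obtain ⟨z, hz⟩ := Finset.card_eq_one.1 (le_antisymm h7 hB.card_pos)
      have hzX : z ∈ X ∩ W := by simp [hz]
      have e3 : X = {v, z} := by
        ext x
        have i1 : x ∈ X ∩ Z ↔ False := by simp [hA]
        have i2 : x ∈ X ∩ W ↔ x = z := by simp [hz]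
        have := c2 x
        grind
      have hzu : z ≠ u := fun e => huX (e ▸ (Finset.mem_inter.1 hzX).1)
      have hzv : z ≠ v := fun e => hvW (e ▸ (Finset.mem_inter.1 hzX).2)
      have hzw : z ≠ w := fun e => hwX (e ▸ (Finset.mem_inter.1 hzX).1)
      have h8 := h.conn_left
      rw [e3] at h8
      obtain ⟨s, hs⟩ := hL.exists_isTriple hn huv hzu.symm hzv.symm h8
      exact ⟨s, z, hzu, hzv, hzw, Or.inl hs⟩
    · have h6 := conn_insert_of_forall (L := L) huC fun p hp => by
        have i1 : p u = 0 ∨ p u = t u := by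
          refine eq_zero_or_eq hp.1 ht.mem ht.fst fun x hx => ?_
          by_cases hxv : x = v
          · exact Or.inl (hp.2 x (by simp [hxv, huv.symm, hvY]))
          by_cases hxw : x = w
          · exact Or.inl (hp.2 x (by simp [hxw, huw.symm, hwZ]))
          exact Or.inr (ht.zero x hx hxv hxw)
        have i2 := h.symm.eq_zero_or hb0 hp fun x hx => by
          rcases Finset.mem_insert.1 hx with rfl | hx
          · exact huX
          · exact fun e => d1 x e (Finset.mem_inter.1 hx).1
        rcases i1 with e | e
        · exact e
        rcases i2 with e' | e'
        · exact e'
        · exact absurd (e.symm.trans e') htb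
      have h7 := hL.card_le_one (X := Y ∩ Z) (by omega) hvw (by simp [hvY]) (by simp [hwZ])
      obtain ⟨z, hz⟩ := Finset.card_eq_one.1 (le_antisymm h7 hC.card_pos)
      have hzX : z ∈ Y ∩ Z := by simp [hz]
      have e3 : Y = {w, z} := by
        ext x
        have i1 : x ∈ (Y ∩ W).erase w ↔ False := by simp [hD]
        have i2 : x ∈ Y ∩ Z ↔ x = z := by simp [hz]
        have := c2 x
        grind
      have hzu : z ≠ u := fun e => huY (e ▸ (Finset.mem_inter.1 hzX).1)
      have hzv : z ≠ v := fun e => hvY (e ▸ (Finset.mem_inter.1 hzX).1)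
      have hzw : z ≠ w := fun e => hwZ (e ▸ (Finset.mem_inter.1 hzX).2)
      have h8 := h.conn_right
      rw [e3] at h8
      obtain ⟨s, hs⟩ := hL.exists_isTriple hn huw hzu.symm hzw.symm h8
      exact ⟨s, z, hzu, hzv, hzw, Or.inr hs⟩
  rcases Finset.eq_empty_or_nonempty ((Y ∩ W).erase w) with hD | hD
  · refine key (Or.inr hD) ?_ ?_
    · obtain ⟨x, hx, hxw⟩ := Finset.exists_mem_ne (lt_of_lt_of_le one_lt_two h'.card_right) w
      have i1 : x ∈ (Y ∩ W).erase w ↔ False := by simp [hD]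
      have := c1 x
      exact ⟨x, by grind⟩
    · obtain ⟨x, hx, hxw⟩ := Finset.exists_mem_ne (lt_of_lt_of_le one_lt_two h.card_right) w
      have i1 : x ∈ (Y ∩ W).erase w ↔ False := by simp [hD]
      have := c2 x
      exact ⟨x, by grind⟩
  rcases Finset.eq_empty_or_nonempty (X ∩ Z) with hA | hA
  · refine key (Or.inl hA) ?_ ?_
    · obtain ⟨x, hx, hxw⟩ := Finset.exists_mem_ne (lt_of_lt_of_le one_lt_two h.card_left) v
      have i1 : x ∈ X ∩ Z ↔ False := by simp [hA]
      have := c2 x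
      exact ⟨x, by grind⟩
    · obtain ⟨x, hx, hxw⟩ := Finset.exists_mem_ne (lt_of_lt_of_le one_lt_two h'.card_left) u
      have i1 : x ∈ X ∩ Z ↔ False := by simp [hA]
      have := c1 x
      exact ⟨x, by grind⟩
  have huA : u ∉ insert v (X ∩ Z) := by simp [huv, huX]
  have hvA : v ∉ X ∩ Z := by simp [hvZ]
  -- Here `Y ∩ W` contains `w` and another vertex, so its connectivity is at least 2, and
  -- submodularity leaves at most 2 for the opposite corner with `u` and `v` added.
  have hAuv : L.conn (insert u (insert v (X ∩ Z))) ≤ 2 := by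
    have e1 : insert u X ∩ insert v Z = insert u (insert v (X ∩ Z)) := by grind
    have e2 : (insert u X ∪ insert v Z)ᶜ = Y ∩ W := by
      ext x
      have := c1 x; have := c2 x; have := d1 x; have := d2 x
      grind [Finset.mem_compl]
    have h1 := conn_submodular (L := L) (insert u X) (insert v Z)
    rw [← conn_compl (insert u X ∪ insert v Z), e1, e2] at h1
    have h2 := h.conn_left
    have h3 := h'.conn_left
    have h4 : 2 ≤ L.conn (Y ∩ W) := by
      refine hL.two_le_conn ?_ huv (by simp [huY]) (by simp [hvW])
      obtain ⟨x, hx⟩ := hD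
      exact Finset.one_lt_card.2 ⟨x, (Finset.mem_erase.1 hx).2, w, by simp [hwY, hwW],
        (Finset.mem_erase.1 hx).1⟩
    omega
  -- The value at `u` is 0 or `b`; once it is 0, the value at `v` lies in both `{0, c}` and `{0, t
  -- v}` and vanishes too. Removing both vertices thus costs at most one dimension and lowers the
  -- connectivity.
  have hdim : finrank (ZMod 2) (L.supported (insert u (insert v (X ∩ Z)))) ≤
      finrank (ZMod 2) (L.supported (X ∩ Z)) + 1 := by
    refine finrank_le_add_one u b (fun p hp => h.eq_zero_or hb0 hp fun x hx => ?_)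
      fun p hp hpu => ⟨hp.1, fun x hx => ?_⟩
    · have := d1 x
      grind [Finset.mem_compl]
    · have i1 : p v = 0 ∨ p v = c := h'.eq_zero_or hc0 hp fun x hx => by
        have := d2 x
        grind
      have i2 : p v = 0 ∨ p v = t v := by
        refine eq_zero_or_eq hp.1 ht.mem ht.mid fun x hx => ?_
        by_cases hxu : x = u
        · exact Or.inl (hxu ▸ hpu)
        by_cases hxw : x = w
        · exact Or.inl (hp.2 x (by simp [hxw, huw.symm, hvw.symm, hwX]))
        exact Or.inr (ht.zero x hxu hx hxw)
      have hpv : p v = 0 := by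
        rcases i2 with e | e
        · exact e
        rcases i1 with e' | e'
        · exact e'
        · exact absurd (e.symm.trans e') htc
      by_cases hxu : x = u
      · rw [hxu, hpu]
      by_cases hxv : x = v
      · rw [hxv, hpv]
      exact hp.2 x (by simp only [Finset.mem_insert, hxu, hxv, hx, or_self, not_false_eq_true])
  have hA1 : L.conn (X ∩ Z) ≤ 1 := by
    unfold conn at hAuv ⊢
    rw [Finset.card_insert_of_notMem huA, Finset.card_insert_of_notMem hvA] at hAuv
    push_cast at hAuv
    omega
  have h7 := hL.card_le_one hA1 huv (by simp [huX]) (by simp [hvZ])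
  obtain ⟨z, hz⟩ := Finset.card_eq_one.1 (le_antisymm h7 hA.card_pos)
  have hzX : z ∈ X ∩ Z := by simp [hz]
  have hzu : z ≠ u := fun e => huX (e ▸ (Finset.mem_inter.1 hzX).1)
  have hzv : z ≠ v := fun e => hvZ (e ▸ (Finset.mem_inter.1 hzX).2)
  have hzw : z ≠ w := fun e => hwX (e ▸ (Finset.mem_inter.1 hzX).1)
  rw [hz] at hAuv
  obtain ⟨s, hs⟩ := hL.exists_isTriple hn huv hzu.symm hzv.symm hAuv
  exact ⟨s, z, hzu, hzv, hzw, Or.inl hs⟩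

end IsotropicSystem

/-! ### Chains of triples -/

namespace IsotropicSystem

variable {V : Type*} [Fintype V] {L : IsotropicSystem V}

variable (L) in
/-- The vertices `p 0, …, p (k - 1)` are distinct and any three consecutive ones form a triple. -/
structure IsChain (k : ℕ) (p : ℕ → V) : Prop where
  inj : ∀ i < k, ∀ j < k, p i = p j → i = j
  triple : ∀ i, i + 2 < k → ∃ t, L.IsTriple t (p i) (p (i + 1)) (p (i + 2))

namespace IsChain

variable {k : ℕ} {p : ℕ → V}

lemma ne (h : L.IsChain k p) {i j : ℕ} (hi : i < k) (hj : j < k) (hij : i ≠ j) : p i ≠ p j :=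
  fun e => hij (h.inj i hi j hj e)

lemma reverse (h : L.IsChain k p) : L.IsChain k fun i => p (k - 1 - i) where
  inj i hi j hj e := by
    have := h.inj (k - 1 - i) (by omega) (k - 1 - j) (by omega) e
    omega
  triple i hi := by
    obtain ⟨t, ht⟩ := h.triple (k - 1 - (i + 2)) (by omega)
    refine ⟨t, ?_⟩
    have e1 : k - 1 - (i + 2) + 1 = k - 1 - (i + 1) := by omega
    have e2 : k - 1 - (i + 2) + 2 = k - 1 - i := by omega
    rw [e1, e2] at ht
    exact ht.reverse

lemma prepend (h : L.IsChain k p) {z : V} (hz : ∀ i < k, p i ≠ z) {t : V → Pauli}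
    (ht : L.IsTriple t z (p 0) (p 1)) : ∃ q, L.IsChain (k + 1) q := by
  refine ⟨fun i => Nat.casesOn i z p, ⟨?_, ?_⟩⟩
  · rintro (_ | i) hi (_ | j) hj e
    · rfl
    · exact absurd e.symm (hz j (by omega))
    · exact absurd e (hz i (by omega))
    · rw [h.inj i (by omega) j (by omega) e]
  · rintro (_ | i) hi
    · exact ⟨t, ht⟩
    · exact h.triple i (by omega)

end IsChain

lemma IsTriple.isChain {t s : V → Pauli} {a b c d : V} (h : L.IsTriple t a b c)
    (h' : L.IsTriple s b c d) (had : a ≠ d) :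
    L.IsChain 4 fun i => match i with | 0 => a | 1 => b | 2 => c | _ => d := by
  have := h.ne_fst
  have := h.ne_mid
  have := h.ne_lst
  have := h'.ne_mid
  have := h'.ne_lst
  refine ⟨fun i hi j hj e => ?_, fun i hi => ?_⟩
  · interval_cases i <;> interval_cases j <;> simp_all
  · have : i = 0 ∨ i = 1 := by omega
    rcases this with rfl | rfl
    · exact ⟨t, h⟩
    · exact ⟨s, h'⟩

variable [DecidableEq V]

/-- The set `{p i, …, p (i + m - 1)}`. -/
def interval (p : ℕ → V) (i m : ℕ) : Finset V := (Finset.range m).image fun j => p (i + j)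

lemma mem_interval {p : ℕ → V} {i m j : ℕ} (h1 : i ≤ j) (h2 : j < i + m) :
    p j ∈ interval p i m :=
  Finset.mem_image.2 ⟨j - i, Finset.mem_range.2 (by omega), by congr 1; omega⟩

lemma interval_succ (p : ℕ → V) (i m : ℕ) :
    interval p i (m + 1) = insert (p (i + m)) (interval p i m) := by
  rw [interval, Finset.range_add_one, Finset.image_insert]; rfl

lemma card_interval_le (p : ℕ → V) (i m : ℕ) : (interval p i m).card ≤ m :=
  Finset.card_image_le.trans (Finset.card_range m).le

namespace IsChain

variable {k : ℕ} {p : ℕ → V}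

lemma notMem_interval (h : L.IsChain k p) {i m j : ℕ} (him : i + m ≤ k) (hj : j < k)
    (hne : j < i ∨ i + m ≤ j) : p j ∉ interval p i m := by
  intro hmem
  obtain ⟨l, hl, e⟩ := Finset.mem_image.1 hmem
  have hl := Finset.mem_range.1 hl
  have := h.inj (i + l) (by omega) j hj e
  omega

lemma card_interval (h : L.IsChain k p) {i m : ℕ} (him : i + m ≤ k) :
    (interval p i m).card = m := by
  rw [interval, Finset.card_image_of_injOn, Finset.card_range]
  intro a ha b hb e
  have ha := Finset.mem_range.1 ha
  have hb := Finset.mem_range.1 hb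
  have := h.inj (i + a) (by omega) (i + b) (by omega) e
  omega

/-- From the third vertex on, each new vertex completes a triple with its two predecessors, so the
connectivity does not increase. -/
lemma conn_interval_le (h : L.IsChain k p) {i m : ℕ} (him : i + m ≤ k) :
    L.conn (interval p i m) ≤ 2 := by
  induction m with
  | zero => exact (conn_le_card _).trans (by have := card_interval_le p i 0; omega)
  | succ m ih =>
    by_cases hm : m < 2
    · exact (conn_le_card _).trans (by have := card_interval_le p i (m + 1); omega)
    · obtain ⟨t, ht⟩ := h.triple (i + m - 2) (by omega)
      have e1 : i + m - 2 + 1 = i + m - 1 := by omega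
      have e2 : i + m - 2 + 2 = i + m := by omega
      rw [e1, e2] at ht
      rw [interval_succ]
      refine (conn_insert_le (h.notMem_interval (by omega) (by omega) (by omega))
        (ht.mem_supported ?_ ?_ ?_) ht.lst).trans (ih (by omega))
      · exact Finset.mem_insert_of_mem (mem_interval (by omega) (by omega))
      · exact Finset.mem_insert_of_mem (mem_interval (by omega) (by omega))
      · exact Finset.mem_insert_self _ _

/-- The complement of a long interval of a chain is a triple. -/
lemma exists_isTriple_compl (hL : L.Prime) (hn : 5 ≤ Fintype.card V) (h : L.IsChain k p)
    {i : ℕ} (hi : i + (Fintype.card V - 3) ≤ k) {u v w : V} (huv : u ≠ v) (huw : u ≠ w)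
    (hvw : v ≠ w) (hu : u ∉ interval p i (Fintype.card V - 3))
    (hv : v ∉ interval p i (Fintype.card V - 3)) (hw : w ∉ interval p i (Fintype.card V - 3)) :
    ∃ t, L.IsTriple t u v w := by
  have hc : ({u, v, w} : Finset V).card = 3 := Finset.card_eq_three.2 ⟨u, v, w, huv, huw, hvw, rfl⟩
  have : ({u, v, w} : Finset V) = (interval p i (Fintype.card V - 3))ᶜ := by
    refine Finset.eq_of_subset_of_card_le (fun x hx => ?_) ?_
    · simp only [Finset.mem_insert, Finset.mem_singleton] at hx
      rw [Finset.mem_compl]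
      rcases hx with rfl | rfl | rfl <;> assumption
    · rw [Finset.card_compl, h.card_interval hi, hc]; omega
  refine hL.exists_isTriple (by omega) huv huw hvw ?_
  rw [this, conn_compl]
  exact h.conn_interval_le hi

/-- Two distinct nonzero values at the last vertex make the connectivity drop below that of the
interval of length `m`, hence to at most 1. -/
lemma false_of_two_types (hL : L.Prime) (h : L.IsChain k p) {m : ℕ} (hm : 1 ≤ m) (hmk : m < k)
    (hn : m + 3 ≤ Fintype.card V) {x y : V → Pauli}
    (hx : x ∈ L.supported (interval p 0 (m + 1))) (hxm : x (p m) ≠ 0)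
    (hy : y ∈ L.supported (interval p 0 (m + 1))) (hym : y (p m) ≠ 0) (hxy : x (p m) ≠ y (p m)) :
    False := by
  have h1 := h.conn_interval_le (i := 0) (m := m) (by omega)
  have h2 := h.card_interval (i := 0) (m := m + 1) (by omega)
  have h3 := hL (interval p 0 (m + 1)) (by omega) (by omega)
  rw [interval_succ, zero_add] at hx hy h3
  have h4 := conn_insert_lt (h.notMem_interval (by omega) hmk (by omega)) hx hxm hy hym hxy
  omega

end IsChain

variable (L) in
/-- At least two of the minors at `v` are not prime. -/
def TwoBlocked (v : V) : Prop :=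
  ∃ a b : Pauli, a ≠ 0 ∧ b ≠ 0 ∧ a ≠ b ∧ L.Blocked v a ∧ L.Blocked v b

lemma TwoBlocked.exists_ne {v : V} (h : L.TwoBlocked v) (c : Pauli) :
    ∃ a, a ≠ 0 ∧ c ≠ a ∧ L.Blocked v a := by
  obtain ⟨a, b, ha, hb, hab, h1, h2⟩ := h
  by_cases e : c = a
  · exact ⟨b, hb, e ▸ hab, h2⟩
  · exact ⟨a, ha, e, h1⟩

lemma Prime.exists_chain_of_blocked_pair (hL : L.Prime) (hn : 5 ≤ Fintype.card V) {t : V → Pauli}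
    {u v w : V} (ht : L.IsTriple t u v w) (hu : L.TwoBlocked u) (hv : L.TwoBlocked v) :
    ∃ p, L.IsChain 4 p := by
  obtain ⟨b, hb0, htb, hb⟩ := hu.exists_ne (t u)
  obtain ⟨c, hc0, htc, hc⟩ := hv.exists_ne (t v)
  obtain ⟨s, z, hzu, hzv, hzw, hs | hs⟩ :=
    hL.exists_adjacent_triple (by omega) ht hb0 hc0 htb htc hb hc
  · exact ⟨_, ht.rotate.rotate.isChain hs hzw.symm⟩
  · exact ⟨_, ht.swap_left.isChain hs hzv.symm⟩

lemma Prime.exists_chain_four (hL : L.Prime) (hn : 5 ≤ Fintype.card V)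
    (hB : ∀ u v, u ≠ v → L.TwoBlocked u ∨ L.TwoBlocked v) : ∃ p, L.IsChain 4 p := by
  obtain ⟨u, hu⟩ : ∃ u, L.TwoBlocked u := by
    obtain ⟨a, b, hab⟩ := Fintype.exists_pair_of_one_lt_card (α := V) (by omega)
    rcases hB a b hab with h | h
    exacts [⟨a, h⟩, ⟨b, h⟩]
  obtain ⟨a, b, ha, hb, hab, h1, h2⟩ := id hu
  obtain ⟨t, v, w, ht⟩ := hL.exists_isTriple_of_blocked (by omega) ha hb hab h1 h2
  rcases hB v w ht.ne_lst with hv | hw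
  · exact hL.exists_chain_of_blocked_pair hn ht hu hv
  · exact hL.exists_chain_of_blocked_pair hn ht.swap_right hu hw

namespace IsChain

variable {k : ℕ} {p : ℕ → V}

/-- The adjacent triple lemma at `p 0`, `p 1` gives a triple through `p 0`, one of `p 1`, `p 2`, and
a third vertex `z`. A new `z` prolongs the chain, after an exchange of `p 1` and `p 2` if necessary;
a `z` on the chain contradicts the overlap rules or primeness. -/
lemma exists_succ_of_twoBlocked (hL : L.Prime) (hk : 4 ≤ k) (hkn : k + 2 ≤ Fintype.card V)
    (h : L.IsChain k p) (h0 : L.TwoBlocked (p 0)) : ∃ q, L.IsChain (k + 1) q := by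
  have hn : 4 ≤ Fintype.card V := by omega
  have hne : ∀ {i j : ℕ}, i < k → j < k → i ≠ j → p i ≠ p j := h.ne
  obtain ⟨t, ht⟩ := h.triple 0 (by omega)
  obtain ⟨t', ht'⟩ := h.triple 1 (by omega)
  simp only [zero_add, Nat.reduceAdd] at ht ht'
  -- The triple starting at `p 1` blocks `p 1` in a type other than that of `t`, so `p 1` need not
  -- be assumed twice blocked.
  have htt' : t (p 1) ≠ t' (p 1) := ht.rotate.differ hL hn ht' (hne (by omega) (by omega) (by omega))
  obtain ⟨b, hb0, htb, hb⟩ := h0.exists_ne (t (p 0))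
  obtain ⟨s, z, hz0, hz1, hz2, hs⟩ := hL.exists_adjacent_triple hn ht hb0 ht'.fst htb htt' hb
    (ht'.blocked (by omega) hL)
  have hmem : ∀ {m j : ℕ}, j < m → p j ∈ interval p 0 m := fun hj => mem_interval (by omega) (by omega)
  rcases hs with hs | hs
  · by_cases hz : ∀ i < k, p i ≠ z
    · exact h.prepend hz hs.rotate.rotate
    push Not at hz
    obtain ⟨j, hj, rfl⟩ := hz
    have hj3 : 3 ≤ j := by
      by_contra hlt
      interval_cases j <;> contradiction
    exfalso
    rcases hj3.eq_or_lt with rfl | hj4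
    · exact h.false_of_two_types hL (m := 3) (by omega) (by omega) (by omega)
        (hs.mem_supported (hmem (by omega)) (hmem (by omega)) (hmem (by omega))) hs.lst
        (ht'.mem_supported (hmem (by omega)) (hmem (by omega)) (hmem (by omega))) ht'.lst
        (hs.reverse.differ hL hn ht'.rotate.rotate (hne (by omega) (by omega) (by omega)))
    obtain ⟨r, hr⟩ := h.triple (j - 2) (by omega)
    rw [show j - 2 + 1 = j - 1 by omega, show j - 2 + 2 = j by omega] at hr
    have hsr : s (p j) = r (p j) := hs.reverse.agree hr.reverse (hne (by omega) (by omega) (by omega))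
      (hne (by omega) (by omega) (by omega)) (hne (by omega) (by omega) (by omega))
      (hne (by omega) (by omega) (by omega))
    -- If `p j` is not the last vertex, `s` agrees at `p j` with two consecutive chain triples,
    -- which differ there.
    by_cases hjk : j + 1 < k
    · obtain ⟨r', hr'⟩ := h.triple (j - 1) (by omega)
      rw [show j - 1 + 1 = j by omega, show j - 1 + 2 = j + 1 by omega] at hr'
      have hsr' : s (p j) = r' (p j) := hs.reverse.agree hr'.swap_left
        (hne (by omega) (by omega) (by omega)) (hne (by omega) (by omega) (by omega))
        (hne (by omega) (by omega) (by omega)) (hne (by omega) (by omega) (by omega))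
      exact hr.reverse.differ hL hn hr'.swap_left (hne (by omega) (by omega) (by omega))
        (hsr.symm.trans hsr')
    · have hts : t (p 0) ≠ s (p 0) := ht.differ hL hn hs (hne (by omega) (by omega) (by omega))
      have h1 := h.conn_interval_le (i := 1) (m := j - 1) (by omega)
      have h2 := h.card_interval (i := 1) (m := j - 1) (by omega)
      have h3 : p 0 ∉ interval p 1 (j - 1) := h.notMem_interval (by omega) (by omega) (by omega)
      have hmem' : ∀ {i : ℕ}, i < j → p i ∈ insert (p 0) (interval p 1 (j - 1)) := fun {i} hi => by
        rcases Nat.eq_zero_or_pos i with rfl | hi0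
        · exact Finset.mem_insert_self _ _
        · exact Finset.mem_insert_of_mem (mem_interval (by omega) (by omega))
      have hr0 : r (p 0) = 0 := hr.zero _ (hne (by omega) (by omega) (by omega))
        (hne (by omega) (by omega) (by omega)) (hne (by omega) (by omega) (by omega))
      -- At the last vertex `s` and `r` cancel, so `t` and `s + r` are supported on `p 0, …, p (j -
      -- 1)` with different nonzero values at `p 0`; the connectivity of that set is then at most 1.
      have h4 := conn_insert_lt h3 (x := t) (y := s + r)
        (ht.mem_supported (hmem' (by omega)) (hmem' (by omega)) (hmem' (by omega))) ht.fst
        ⟨L.carrier.add_mem hs.mem hr.mem, fun x hx => by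
          by_cases hxj : x = p j
          · rw [hxj, Pi.add_apply, hsr, add_self]
          have hxi : ∀ i < j, x ≠ p i := fun i hi e => hx (e ▸ hmem' hi)
          rw [Pi.add_apply, hs.zero x (hxi _ (by omega)) (hxi _ (by omega)) hxj,
            hr.zero x (hxi _ (by omega)) (hxi _ (by omega)) hxj, add_zero]⟩
        (by rw [Pi.add_apply, hr0, add_zero]; exact hs.fst)
        (by rw [Pi.add_apply, hr0, add_zero]; exact hts)
      have h5 := hL (insert (p 0) (interval p 1 (j - 1)))
        (by rw [Finset.card_insert_of_notMem h3]; omega)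
        (by rw [Finset.card_insert_of_notMem h3]; omega)
      omega
  -- Both `t` and `s` would agree at `p 2` with the triple of `p 2`, `p 3`, `p 4`, yet they differ
  -- there because they share exactly `p 0` and `p 2`.
  · have key : 5 ≤ k → z ≠ p 3 → z ≠ p 4 → False := by
      intro hk5 hz3 hz4
      obtain ⟨r, hr⟩ := h.triple 2 (by omega)
      have e1 : t (p 2) = r (p 2) := ht.reverse.agree hr (hne (by omega) (by omega) (by omega))
        (hne (by omega) (by omega) (by omega)) (hne (by omega) (by omega) (by omega))
        (hne (by omega) (by omega) (by omega))
      have e2 : s (p 2) = r (p 2) := hs.swap_left.agree hr (hne (by omega) (by omega) (by omega))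
        (hne (by omega) (by omega) (by omega)) hz3 hz4
      exact ht.rotate.rotate.differ hL hn hs.swap_left hz1.symm (e1.trans e2.symm)
    by_cases hz : ∀ i < k, p i ≠ z
    · rcases hk.eq_or_lt with rfl | hk5
      -- For a chain of four, the order `p 0, p 2, p 1, p 3` is also a chain, and `z` precedes it.
      · exact (ht.swap_right.isChain ht'.swap_left (hne (by omega) (by omega) (by omega))).prepend
          (fun i hi => by interval_cases i <;> exact hz _ (by omega)) hs.rotate.rotate
      · exact (key hk5 (hz 3 (by omega)).symm (hz 4 (by omega)).symm).elim
    push Not at hz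
    obtain ⟨j, hj, rfl⟩ := hz
    have hj3 : 3 ≤ j := by
      by_contra hlt
      interval_cases j <;> contradiction
    exfalso
    rcases hj3.eq_or_lt with rfl | hj4
    · exact h.false_of_two_types hL (m := 3) (by omega) (by omega) (by omega)
        (hs.mem_supported (hmem (by omega)) (hmem (by omega)) (hmem (by omega))) hs.lst
        (ht'.mem_supported (hmem (by omega)) (hmem (by omega)) (hmem (by omega))) ht'.lst
        (hs.reverse.differ hL hn ht'.reverse (hne (by omega) (by omega) (by omega)))
    rcases Nat.eq_or_lt_of_le hj4 with rfl | hj5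
    · obtain ⟨r, hr⟩ := h.triple 2 (by omega)
      exact h.false_of_two_types hL (m := 4) (by omega) (by omega) (by omega)
        (hs.mem_supported (hmem (by omega)) (hmem (by omega)) (hmem (by omega))) hs.lst
        (hr.mem_supported (hmem (by omega)) (hmem (by omega)) (hmem (by omega))) hr.lst
        (hs.reverse.differ hL hn hr.rotate.rotate (hne (by omega) (by omega) (by omega)))
    · exact key (by omega) (hne hj (by omega) (by omega)) (hne hj (by omega) (by omega))

/-- One of the two ends is twice blocked, and the chain may be reversed. When a single vertex `z` is
missing, no blocking is needed: `z`, `p 0`, `p 1` are the complement of an interval, hence a triple.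
-/
lemma exists_succ (hL : L.Prime) (hk : 4 ≤ k) (hkn : k < Fintype.card V)
    (hB : ∀ u v, u ≠ v → L.TwoBlocked u ∨ L.TwoBlocked v)
    (h : L.IsChain k p) : ∃ q, L.IsChain (k + 1) q := by
  by_cases hk2 : k + 2 ≤ Fintype.card V
  · rcases hB _ _ (h.ne (i := 0) (j := k - 1) (by omega) (by omega) (by omega)) with h0 | h0
    · exact h.exists_succ_of_twoBlocked hL hk hk2 h0
    · exact h.reverse.exists_succ_of_twoBlocked hL hk hk2 h0
  · have hc := h.card_interval (i := 0) (m := k) (by omega)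
    obtain ⟨z, hz⟩ : ∃ z, z ∉ interval p 0 k := by
      by_contra! hall
      have := Finset.card_le_card (fun x _ => hall x : Finset.univ ⊆ interval p 0 k)
      rw [Finset.card_univ] at this
      omega
    have hz' : ∀ i < k, p i ≠ z := fun i hi e => hz (e ▸ mem_interval (by omega) (by omega))
    obtain ⟨t, ht⟩ := h.exists_isTriple_compl hL (by omega) (i := 2) (by omega)
      (hz' 0 (by omega)).symm (hz' 1 (by omega)).symm (h.ne (by omega) (by omega) (by omega))
      (fun hm => by
        obtain ⟨l, hl, e⟩ := Finset.mem_image.1 hm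
        have hl := Finset.mem_range.1 hl
        exact hz' _ (by omega) e)
      (h.notMem_interval (by omega) (by omega) (by omega))
      (h.notMem_interval (by omega) (by omega) (by omega))
    exact h.prepend hz' ht

end IsChain

lemma Prime.exists_spanning_chain (hL : L.Prime) (hn : 5 ≤ Fintype.card V)
    (hB : ∀ u v, u ≠ v → L.TwoBlocked u ∨ L.TwoBlocked v) :
    ∃ p, L.IsChain (Fintype.card V) p := by
  have : ∀ k, 4 ≤ k → k ≤ Fintype.card V → ∃ p, L.IsChain k p := by
    intro k hk
    induction k, hk using Nat.le_induction with
    | base => exact fun _ => hL.exists_chain_four hn hB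
    | succ k hk ih =>
      intro hkn
      obtain ⟨p, hp⟩ := ih (by omega)
      exact hp.exists_succ hL hk (by omega) hB
  exact this _ (by omega) le_rfl

end IsotropicSystem

/-! ### Presentations of isotropic systems by graphs -/

/-- The vector with coordinates `f w • b w + c • a w` at `w`, where `c` is the sum of `f` over the
neighbours of `w`. -/
noncomputable def SimpleGraph.combine {V : Type*} [Fintype V] (G : SimpleGraph V)
    (a b : V → Pauli) :
    (V → ZMod 2) →ₗ[ZMod 2] (V → Pauli) := by
  classical exact
  { toFun := fun f w => f w • b w + (∑ u, if G.Adj u w then f u else 0) • a w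
    map_add' := fun f g => by
      funext w
      have : (∑ u, if G.Adj u w then (f + g) u else 0) =
          (∑ u, if G.Adj u w then f u else 0) + ∑ u, if G.Adj u w then g u else 0 := by
        rw [← Finset.sum_add_distrib]
        exact Finset.sum_congr rfl fun u _ => by split_ifs <;> simp
      rw [this, Pi.add_apply, Pi.add_apply, add_smul, add_smul]
      abel
    map_smul' := fun r f => by
      funext w
      have : (∑ u, if G.Adj u w then (r • f) u else 0) =
          r * ∑ u, if G.Adj u w then f u else 0 := by
        rw [Finset.mul_sum]
        exact Finset.sum_congr rfl fun u _ => by split_ifs <;> simp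
      rw [this, Pi.smul_apply, Pi.smul_apply, smul_add, smul_eq_mul, mul_smul, mul_smul,
        RingHom.id_apply] }

namespace IsotropicSystem

open SimpleGraph
open scoped Classical in
lemma combine_apply {V : Type*} [Fintype V] (G : SimpleGraph V) (a b : V → Pauli) (f : V → ZMod 2)
    (w : V) : G.combine a b f w = f w • b w + (∑ u, if G.Adj u w then f u else 0) • a w := rfl

lemma symp_combine {V : Type*} [Fintype V] {G : SimpleGraph V} {a b : V → Pauli} {w : V}
    (ha : a w ≠ 0) (hb : b w ≠ 0) (hab : a w ≠ b w) (f : V → ZMod 2) :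
    symp (G.combine a b f w) (a w) = f w := by
  rw [combine_apply, symp_add_left, symp_smul_left, symp_smul_left, symp_self,
    symp_eq_one _ _ hb ha hab.symm, mul_one, mul_zero, add_zero]

lemma combine_injective {V : Type*} [Fintype V] {G : SimpleGraph V} {a b : V → Pauli}
    (ha : ∀ w, a w ≠ 0) (hb : ∀ w, b w ≠ 0) (hab : ∀ w, a w ≠ b w) :
    Function.Injective (G.combine a b) := fun f g h => by
  funext w
  rw [← symp_combine (G := G) (ha w) (hb w) (hab w) f, h, symp_combine (ha w) (hb w) (hab w)]

section Row

variable {V : Type*}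

open scoped Classical in
/-- The vector of the vertex `v` in the presentation of an isotropic system by a graph. -/
noncomputable def row (G : SimpleGraph V) (a b : V → Pauli) (v w : V) : Pauli :=
  if w = v then b v else if G.Adj v w then a w else 0

variable {G : SimpleGraph V} {a b : V → Pauli} {v w : V}

lemma row_self : row G a b v v = b v := by simp [row]

lemma row_of_adj (h : G.Adj v w) : row G a b v w = a w := by simp [row, h, h.ne']

lemma row_of_not_adj (hvw : w ≠ v) (h : ¬ G.Adj v w) : row G a b v w = 0 := by simp [row, h, hvw]

lemma row_eq_zero_or (hvw : w ≠ v) : row G a b v w = 0 ∨ row G a b v w = a w := by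
  by_cases h : G.Adj v w
  · exact Or.inr (row_of_adj h)
  · exact Or.inl (row_of_not_adj hvw h)

end Row

variable {V : Type*} [Fintype V] {L : IsotropicSystem V} {G : SimpleGraph V} {a b : V → Pauli}

lemma combine_eq_sum (f : V → ZMod 2) : G.combine a b f = ∑ u, f u • row G a b u := by
  classical
  funext w
  rw [combine_apply, Finset.sum_apply, Finset.sum_smul,
    ← Finset.add_sum_erase Finset.univ (fun u => (f u • row G a b u) w) (Finset.mem_univ w),
    ← Finset.add_sum_erase Finset.univ (fun u => (if G.Adj u w then f u else 0) • a w)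
      (Finset.mem_univ w)]
  simp only [Pi.smul_apply, row_self, SimpleGraph.irrefl, if_false, zero_smul, zero_add]
  congr 1
  refine Finset.sum_congr rfl fun u hu => ?_
  have hwu := (Finset.ne_of_mem_erase hu).symm
  by_cases h : G.Adj u w
  · rw [row_of_adj h, if_pos h]
  · rw [row_of_not_adj hwu h, if_neg h, zero_smul, smul_zero]

/-- The isotropic system of a graph. -/
noncomputable def ofGraph (G : SimpleGraph V) : IsotropicSystem V where
  carrier := LinearMap.range (G.combine (fun _ => (0, 1)) (fun _ => (1, 0)))
  isotropic := by
    classical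
    rintro _ ⟨f, rfl⟩ _ ⟨g, rfl⟩
    have key : ∀ f g : V → ZMod 2, (∑ v, f v * ∑ u, if G.Adj u v then g u else 0) =
        ∑ v, ∑ u, if G.Adj u v then f v * g u else 0 := fun f g => by
      simp only [Finset.mul_sum, mul_ite, mul_zero]
    have key' : (∑ v, f v * ∑ u, if G.Adj u v then g u else 0) =
        ∑ v, g v * ∑ u, if G.Adj u v then f u else 0 := by
      rw [key, key, Finset.sum_comm]
      simp only [G.adj_comm, mul_comm]
    have : ∀ v, symp (G.combine (fun _ => (0, 1)) (fun _ => (1, 0)) f v)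
        (G.combine (fun _ => (0, 1)) (fun _ => (1, 0)) g v) =
        (f v * ∑ u, if G.Adj u v then g u else 0) +
        g v * ∑ u, if G.Adj u v then f u else 0 := fun v => by
      simp [combine_apply, symp, mul_comm]
    simp only [this, Finset.sum_add_distrib]
    rw [key']
    exact CharTwo.add_self_eq_zero _
  finrank_eq := by
    rw [LinearMap.finrank_range_of_inj (combine_injective (by simp) (by simp) (by simp))]
    simp

variable (L) in
/-- The isotropic system `L` is presented by the graph `G`, with types `a` and `b`. -/
structure Presents (G : SimpleGraph V) (a b : V → Pauli) : Prop where
  ne_zero_left : ∀ v, a v ≠ 0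
  ne_zero_right : ∀ v, b v ≠ 0
  ne : ∀ v, a v ≠ b v
  row_mem : ∀ v, row G a b v ∈ L.carrier

lemma ofGraph_presents (G : SimpleGraph V) :
    (ofGraph G).Presents G (fun _ => (0, 1)) (fun _ => (1, 0)) where
  ne_zero_left := by simp
  ne_zero_right := by simp
  ne := by simp
  row_mem v := by
    classical
    refine ⟨Pi.single v 1, ?_⟩
    rw [combine_eq_sum, Finset.sum_eq_single v]
    · rw [Pi.single_eq_same, one_smul]
    · intro w _ hw
      rw [Pi.single_eq_of_ne hw, zero_smul]
    · simp

lemma Presents.combine_mem (h : L.Presents G a b) (f : V → ZMod 2) :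
    G.combine a b f ∈ L.carrier := by
  rw [combine_eq_sum]
  exact Submodule.sum_mem _ fun u _ => Submodule.smul_mem _ _ (h.row_mem u)

open scoped Classical in
-- Adding the row of `v` to the rows of its neighbours complements the adjacencies among them; it
-- changes the entries of these rows at `v` to `a v + b v` and their diagonal entries to `b + a`.
-- The subspace stays the same.
lemma Presents.localComplement [DecidableEq V] (h : L.Presents G a b) (v : V) :
    L.Presents (G.localComplement v) (Function.update a v (a v + b v))
      fun w => if G.Adj v w then b w + a w else b w where
  ne_zero_left w := by
    by_cases hw : w = v
    · subst hw
      rw [Function.update_self, Ne, add_eq_zero]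
      exact h.ne w
    · rw [Function.update_of_ne hw]
      exact h.ne_zero_left w
  ne_zero_right w := by
    split_ifs with hw
    · rw [Ne, add_eq_zero]
      exact (h.ne w).symm
    · exact h.ne_zero_right w
  ne w := by
    have h1 := h.ne_zero_left w
    have h2 := h.ne_zero_right w
    by_cases hw : w = v
    · subst hw
      simpa using h1
    · rw [Function.update_of_ne hw]
      split_ifs with hw
      · simpa using h2
      · exact h.ne w
  row_mem u := by
    by_cases hu : G.Adj v u
    · convert L.carrier.add_mem (h.row_mem u) (h.row_mem v) using 1
      funext w
      have hvu := hu.ne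
      have hvu' := hu.ne'
      by_cases hwv : w = v
      · subst hwv
        have : (G.localComplement w).Adj u w := by
          simp [SimpleGraph.localComplement, Xor, hu.symm]
        rw [row_of_adj this, Pi.add_apply, row_of_adj hu.symm, row_self, Function.update_self]
      · by_cases hwu : w = u
        · subst hwu
          rw [row_self, Pi.add_apply, row_self, row_of_adj hu, if_pos hu]
        · have hx : (G.localComplement v).Adj u w ↔ Xor (G.Adj u w) (G.Adj v w) := by
            simp [SimpleGraph.localComplement, hu, Ne.symm hwu]
          by_cases h1 : G.Adj u w <;> by_cases h2 : G.Adj v w <;>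
            simp [row, hx, h1, h2, hwu, hwv, Xor, add_self]
    · convert h.row_mem u using 1
      funext w
      have hx : (G.localComplement v).Adj u w ↔ G.Adj u w := by
        simp [SimpleGraph.localComplement, hu, Xor]
      by_cases hwu : w = u
      · subst hwu
        rw [row_self, row_self, if_neg hu]
      · by_cases h1 : G.Adj u w
        · have hwv : w ≠ v := fun e => hu (e ▸ h1.symm)
          rw [row_of_adj h1, row_of_adj (hx.2 h1), Function.update_of_ne hwv]
        · rw [row_of_not_adj hwu h1, row_of_not_adj hwu (fun e => h1 (hx.1 e))]

/-- On the types `a`, pivoting installs `b` at the two ends of the edge and changes nothing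
elsewhere; this follows by composing three local complementations. -/
lemma Presents.pivot (h : L.Presents G a b) {v w : V} (hvw : G.Adj v w) :
    ∃ a' b', L.Presents (G.pivot v w) a' b' ∧ a' v = b v ∧ a' w = b w ∧
      ∀ u, u ≠ v → u ≠ w → a' u = a u := by
  classical
  have h1 : (G.localComplement v).Adj w v := by
    simp [SimpleGraph.localComplement, Xor, hvw.symm]
  have h2 : ((G.localComplement v).localComplement w).Adj v w := by
    simp [SimpleGraph.localComplement, Xor, hvw.symm, hvw]
  have key : ∀ x y : Pauli, x + y + (y + (x + y)) = y := by decide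
  have key' : ∀ x y : Pauli, x + (y + x) = y := by decide
  refine ⟨_, _, ((h.localComplement v).localComplement w).localComplement v, ?_, ?_, ?_⟩
  · simp [hvw.ne, hvw.ne', h1, key]
  · simp [hvw.ne, hvw.ne', hvw, key']
  · intro u hu hu'
    simp [hu, hu']

/-- Any choice of types that annihilates no nonzero member of `L` comes from a graph that is
locally equivalent to a given presentation. -/
lemma Presents.exists_locallyEquivalent {a' : V → Pauli} (ha' : ∀ v, a' v ≠ 0)
    (hE : ∀ r ∈ L.carrier, (∀ v, r v = 0 ∨ r v = a' v) → r = 0) (h : L.Presents G a b) :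
    ∃ H b', G.LocallyEquivalent H ∧ L.Presents H a' b' := by
  classical
  induction hm : (Finset.univ.filter fun v => a v ≠ a' v).card using Nat.strong_induction_on
    generalizing G a b with
  | _ m ih =>
  by_cases hD : ∃ v, a v ≠ a' v
  swap
  · push Not at hD
    obtain rfl : a = a' := funext hD
    exact ⟨G, b, Relation.ReflTransGen.refl, h⟩
  -- Induction on the number of vertices where `a` and `a'` differ. If `a' v` is the third type `a v
  -- + b v`, local complementation at `v` installs it.
  by_cases hD' : ∃ v, a v ≠ a' v ∧ b v ≠ a' v
  · obtain ⟨v, h1, h2⟩ := hD'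
    have key : ∀ x y z : Pauli, x ≠ 0 → y ≠ 0 → z ≠ 0 → x ≠ y → x ≠ z → y ≠ z → x + y = z := by
      decide
    have h3 := key _ _ _ (h.ne_zero_left v) (h.ne_zero_right v) (ha' v) (h.ne v) h1 h2
    have hlt : (Finset.univ.filter fun w => Function.update a v (a v + b v) w ≠ a' w).card < m := by
      rw [← hm]
      refine Finset.card_lt_card ⟨fun w hw => ?_, fun hs => ?_⟩
      · rw [Finset.mem_filter] at hw ⊢
        by_cases hwv : w = v
        · rw [hwv]; exact ⟨Finset.mem_univ _, h1⟩
        · rwa [Function.update_of_ne hwv] at hw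
      · have := hs (Finset.mem_filter.2 ⟨Finset.mem_univ v, h1⟩)
        simp [h3] at this
    obtain ⟨H, b', hH, hP⟩ := ih _ hlt (h.localComplement v) rfl
    exact ⟨H, b', Relation.ReflTransGen.head ⟨v, rfl⟩ hH, hP⟩
  · push Not at hD'
    obtain ⟨v, hv⟩ := hD
    -- Now `b` equals `a'` wherever `a` does not. By `hE` the row of `v` violates the types `a'`
    -- somewhere, necessarily at a neighbour `w` with `a w ≠ a' w`; pivoting on `vw` corrects both
    -- vertices.
    obtain ⟨w, hw0, hwa⟩ : ∃ w, row G a b v w ≠ 0 ∧ row G a b v w ≠ a' w := by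
      by_contra! hall
      have := hE _ (h.row_mem v) fun w => or_iff_not_imp_left.2 (hall w)
      have h0 := row_self (G := G) (a := a) (b := b) (v := v)
      rw [this] at h0
      exact h.ne_zero_right v h0.symm
    have hwv : w ≠ v := by
      rintro rfl
      exact hwa (by rw [row_self, hD' w hv])
    have hvw : G.Adj v w := by
      by_contra hn
      exact hw0 (row_of_not_adj hwv hn)
    rw [row_of_adj hvw] at hwa
    obtain ⟨a₁, b₁, hP, h1, h2, h3⟩ := h.pivot hvw
    have hlt : (Finset.univ.filter fun w => a₁ w ≠ a' w).card < m := by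
      rw [← hm]
      refine Finset.card_lt_card ⟨fun x hx => ?_, fun hs => ?_⟩
      · rw [Finset.mem_filter] at hx ⊢
        by_cases hxv : x = v
        · rw [hxv]; exact ⟨Finset.mem_univ _, hv⟩
        by_cases hxw : x = w
        · rw [hxw]; exact ⟨Finset.mem_univ _, hwa⟩
        rwa [h3 x hxv hxw] at hx
      · have := hs (Finset.mem_filter.2 ⟨Finset.mem_univ v, hv⟩)
        simp [h1, hD' v hv] at this
    obtain ⟨H, b', hH, hP'⟩ := ih _ hlt hP rfl
    exact ⟨H, b', Relation.ReflTransGen.head ⟨v, rfl⟩ (Relation.ReflTransGen.head ⟨w, rfl⟩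
      (Relation.ReflTransGen.head ⟨v, rfl⟩ hH)), hP'⟩

end IsotropicSystem

/-! ### Splits and connectivity -/

namespace IsotropicSystem
open SimpleGraph

section Split

variable {V : Type*} [Fintype V] [DecidableEq V] {L : IsotropicSystem V} {G : SimpleGraph V}
  {a b : V → Pauli}

/-- Two distinct nonzero functionals cut out a subspace of codimension two. -/
lemma two_add_finrank_le {R : Submodule (ZMod 2) (V → ZMod 2)} {X : Finset V}
    (g₁ g₂ : (V → ZMod 2) →ₗ[ZMod 2] ZMod 2)
    (hR : ∀ f ∈ R, f ∈ vanishingOff (ZMod 2) X ∧ g₁ f = 0 ∧ g₂ f = 0)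
    {u₁ u₂ u₃ : V} (hu₁ : u₁ ∈ X) (hu₂ : u₂ ∈ X) (hu₃ : u₃ ∈ X)
    (h₁ : g₁ (Pi.single u₁ 1) ≠ 0) (h₂ : g₂ (Pi.single u₂ 1) ≠ 0)
    (h₃ : g₁ (Pi.single u₃ 1) ≠ g₂ (Pi.single u₃ 1)) :
    finrank (ZMod 2) R + 2 ≤ X.card := by
  have hmem : ∀ u ∈ X, (Pi.single u 1 : V → ZMod 2) ∈ vanishingOff (ZMod 2) X := fun u hu v hv =>
    Pi.single_eq_of_ne (fun e => hv (by rwa [e])) _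
  have h01 : ∀ x y : ZMod 2, x ≠ 0 → y ≠ 0 → x = y := by decide
  have lt₁ : vanishingOff (ZMod 2) X ⊓ LinearMap.ker g₁ < vanishingOff (ZMod 2) X :=
    lt_of_le_of_ne inf_le_left fun e => h₁ (e.ge (hmem _ hu₁)).2
  have hex : ∃ f ∈ vanishingOff (ZMod 2) X, g₁ f = 0 ∧ g₂ f ≠ 0 := by
    by_cases hc : g₁ (Pi.single u₂ 1) = 0
    · exact ⟨_, hmem _ hu₂, hc, h₂⟩
    by_cases hc' : g₁ (Pi.single u₃ 1) = 0
    · exact ⟨_, hmem _ hu₃, hc', fun e => h₃ (hc'.trans e.symm)⟩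
    · have h4 : g₂ (Pi.single u₃ 1) = 0 := by
        by_contra h5
        exact h₃ (h01 _ _ hc' h5)
      refine ⟨_, Submodule.add_mem _ (hmem _ hu₂) (hmem _ hu₃), ?_, ?_⟩
      · rw [map_add, h01 _ _ hc hc']
        exact CharTwo.add_self_eq_zero _
      · rwa [map_add, h4, add_zero]
  obtain ⟨f, hf, hf₁, hf₂⟩ := hex
  have lt₂ : R < vanishingOff (ZMod 2) X ⊓ LinearMap.ker g₁ :=
    lt_of_le_of_ne (fun r hr => ⟨(hR r hr).1, (hR r hr).2.1⟩)
      fun e => hf₂ (hR f (e.ge ⟨hf, hf₁⟩)).2.2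
  have i1 := Submodule.finrank_lt_finrank_of_lt lt₁
  have i2 := Submodule.finrank_lt_finrank_of_lt lt₂
  have i3 := finrank_vanishingOff (ZMod 2) X
  rw [Module.finrank_self, mul_one] at i3
  omega

/-- A set of connectivity at most one in the isotropic system of a graph gives a split. -/
lemma isSplit_of_conn_le {X : Finset V} (hX : 2 ≤ X.card) (hX' : X.card + 2 ≤ Fintype.card V)
    (h : (ofGraph G).conn X ≤ 1) : G.IsSplit (X : Set V) (X : Set V)ᶜ := by
  classical
  -- A split means that the nonzero columns of the adjacency matrix between `X` and its complement
  -- coincide. Two different nonzero columns would cut the coefficient space of L_X down by two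
  -- dimensions, giving connectivity at least 2.
  have hsame : ∀ w₁ ∉ X, ∀ w₂ ∉ X, (∃ u ∈ X, G.Adj u w₁) → (∃ u ∈ X, G.Adj u w₂) →
      ∀ u ∈ X, G.Adj u w₁ ↔ G.Adj u w₂ := by
    rintro w₁ hw₁ w₂ hw₂ ⟨u₁, hu₁, h₁⟩ ⟨u₂, hu₂, h₂⟩ u₃ hu₃
    by_contra h₃
    let c : V → (V → ZMod 2) →ₗ[ZMod 2] ZMod 2 := fun w =>
      (LinearMap.snd (ZMod 2) (ZMod 2) (ZMod 2)).comp ((LinearMap.proj w).comp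
        (G.combine (fun _ => (0, 1)) (fun _ => (1, 0))))
    have hc : ∀ u w, c w (Pi.single u 1) = if G.Adj u w then 1 else 0 := fun u w => by
      change (G.combine (fun _ => (0, 1)) (fun _ => (1, 0)) (Pi.single u 1) w).2 = _
      rw [combine_apply, Finset.sum_eq_single u]
      · simp only [Pi.single_eq_same]
        split_ifs <;> simp
      · intro v _ hv
        simp [hv]
      · simp
    let R : Submodule (ZMod 2) (V → ZMod 2) :=
      vanishingOff (ZMod 2) X ⊓ LinearMap.ker (c w₁) ⊓ LinearMap.ker (c w₂)
    have h4 := two_add_finrank_le (R := R) (c w₁) (c w₂) (fun f hf => ⟨hf.1.1, hf.1.2, hf.2⟩)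
      hu₁ hu₂ hu₃ (by simp [hc, h₁]) (by simp [hc, h₂]) (by
        rw [hc, hc]
        by_cases i1 : G.Adj u₃ w₁ <;> by_cases i2 : G.Adj u₃ w₂ <;> simp_all)
    have h5 : (ofGraph G).supported X ≤
        R.map (G.combine (fun _ => (0, 1)) (fun _ => (1, 0))) := by
      rintro _ ⟨⟨f, rfl⟩, hf⟩
      refine ⟨f, ⟨⟨fun v hv => ?_, ?_⟩, ?_⟩, rfl⟩
      · have := congrArg Prod.fst (hf v hv)
        simpa [combine_apply] using this
      · exact congrArg Prod.snd (hf w₁ hw₁)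
      · exact congrArg Prod.snd (hf w₂ hw₂)
    have h6 := (Submodule.finrank_mono h5).trans (Submodule.finrank_map_le _ _)
    unfold conn at h
    omega
  refine ⟨disjoint_compl_right, Set.union_compl_self _, ?_, ?_, {u : V | u ∈ X ∧ ∃ w ∉ X, G.Adj u w},
    fun u hu => hu.1, {w : V | w ∉ X ∧ ∃ u ∈ X, G.Adj u w}, fun w hw => hw.1, fun x hx y hy => ?_⟩
  · exact Finset.one_lt_card_iff_nontrivial.1 hX
  · rw [← Finset.coe_compl]
    refine Finset.one_lt_card_iff_nontrivial.1 ?_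
    rw [Finset.card_compl]
    omega
  · refine ⟨fun hxy => ⟨⟨hx, y, hy, hxy⟩, hy, x, hx, hxy⟩, ?_⟩
    rintro ⟨⟨_, w, hw, hxw⟩, _, hy'⟩
    exact (hsame w hw y hy ⟨x, hx, hxw⟩ hy' x hx).1 hxw

lemma ofGraph_prime (hG : G.IsPrime) : (ofGraph G).Prime := fun X hX hX' => by
  by_contra hlt
  exact hG _ _ (isSplit_of_conn_le hX hX' (by omega))

/-- The combinations of the rows of `X` form a space of dimension |X|. The columns at the outside
vertices other than `v` are zero or all equal, so vanishing there is a single linear condition; this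
leaves dimension |X| - 1 on `insert v X`. If none of these members had value `a v` at `v`, they
would all be supported on `X`, whose connectivity would be at most 1. -/
lemma Presents.conn_le_of_split (hL : L.Prime) (h : L.Presents G a b) {v : V} {X : Finset V}
    {A B : Set V} (hv : v ∉ X) (hX : 2 ≤ X.card) (hX' : X.card + 2 ≤ Fintype.card V)
    (hs : ∀ x ∈ X, ∀ y, y ≠ v → y ∉ X → (G.Adj x y ↔ x ∈ A ∧ y ∈ B)) :
    L.conn (insert v X) ≤ 2 ∧ ∃ x ∈ L.supported (insert v X), x v = a v := by
  classical
  let R := (vanishingOff (ZMod 2) X).map (G.combine a b)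
  have hRX : finrank (ZMod 2) R = X.card := by
    have e := (Submodule.equivMapOfInjective (G.combine a b)
      (combine_injective h.ne_zero_left h.ne_zero_right h.ne)
      (vanishingOff (ZMod 2) X)).finrank_eq
    rw [finrank_vanishingOff, Module.finrank_self, mul_one] at e
    exact e.symm
  have hval : ∀ f ∈ vanishingOff (ZMod 2) X, ∀ w ∉ X, G.combine a b f w =
      (∑ u, if G.Adj u w then f u else 0) • a w := fun f hf w hw => by
    rw [combine_apply, hf w hw, zero_smul, zero_add]
  have h01 : ∀ c : ZMod 2, c = 0 ∨ c = 1 := by decide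
  have htype : ∀ x ∈ R, ∀ w ∉ X, x w = 0 ∨ x w = a w := by
    rintro _ ⟨f, hf, rfl⟩ w hw
    rw [hval f hf w hw]
    rcases h01 (∑ u, if G.Adj u w then f u else 0) with e | e <;> simp [e]
  have hdim : finrank (ZMod 2) R ≤
      finrank (ZMod 2) ↥(R ⊓ L.supported (insert v X)) + 1 := by
    by_cases hy : ∃ y, y ≠ v ∧ y ∉ X ∧ y ∈ B
    · obtain ⟨y, hyv, hyX, hyB⟩ := hy
      refine finrank_le_add_one y (a y) (fun x hx => htype x hx y hyX) ?_
      rintro _ ⟨f, hf, rfl⟩ hy0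
      refine ⟨⟨f, hf, rfl⟩, h.combine_mem f, fun w hw => ?_⟩
      simp only [Finset.mem_insert, not_or] at hw
      rw [hval f hf y hyX, smul_eq_zero] at hy0
      have hy0 := hy0.resolve_right (h.ne_zero_left y)
      rw [hval f hf w hw.2]
      by_cases hwB : w ∈ B
      · have : (∑ u, if G.Adj u w then f u else 0) = ∑ u, if G.Adj u y then f u else 0 := by
          refine Finset.sum_congr rfl fun u _ => ?_
          by_cases hu : u ∈ X
          · simp only [hs u hu w hw.1 hw.2, hs u hu y hyv hyX, hwB, hyB]
          · simp [hf u hu]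
        rw [this, hy0, zero_smul]
      · rw [Finset.sum_eq_zero, zero_smul]
        intro u _
        by_cases hu : u ∈ X
        · simp [hs u hu w hw.1 hw.2, hwB]
        · simp [hf u hu]
    · push Not at hy
      refine le_add_right (Submodule.finrank_mono ?_)
      rintro _ ⟨f, hf, rfl⟩
      refine ⟨⟨f, hf, rfl⟩, h.combine_mem f, fun w hw => ?_⟩
      simp only [Finset.mem_insert, not_or] at hw
      have hwB := hy w hw.1 hw.2
      rw [hval f hf w hw.2, Finset.sum_eq_zero, zero_smul]
      intro u _
      by_cases hu : u ∈ X
      · simp [hs u hu w hw.1 hw.2, hwB]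
      · simp [hf u hu]
  constructor
  · have := Submodule.finrank_mono (inf_le_right : R ⊓ L.supported (insert v X) ≤ _)
    unfold conn
    rw [Finset.card_insert_of_notMem hv]
    omega
  · by_contra! hne
    have : R ⊓ L.supported (insert v X) ≤ L.supported X := fun x hx => ⟨hx.2.1, fun w hw => by
      by_cases hwv : w = v
      · rw [hwv]
        exact (htype x hx.1 v hv).resolve_right (hne x hx.2)
      · exact hx.2.2 w (by simp [hw, hwv])⟩
    have := Submodule.finrank_mono this
    have h2 := hL X hX hX'
    unfold conn at h2
    omega

lemma Presents.blocked (hL : L.Prime) (h : L.Presents G a b) {v : V}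
    (hv : ¬ (G.deleteVertex v).IsPrime) : L.Blocked v (a v) := by
  classical
  unfold SimpleGraph.IsPrime at hv
  push Not at hv
  obtain ⟨A, B, hdisj, hcov, hA, hB, A', hA', B', hB', hs⟩ := hv
  have mem : ∀ (S : Set ↥({v}ᶜ : Set V)) (w : V),
      w ∈ (Subtype.val '' S).toFinset ↔ ∃ hw : w ≠ v, ⟨w, hw⟩ ∈ S := fun S w => by
    simp
  have hvmem : ∀ S : Set ↥({v}ᶜ : Set V), v ∉ (Subtype.val '' S).toFinset := fun S => by
    rw [mem]; rintro ⟨h, _⟩; exact h rfl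
  have hcard : ∀ S : Set ↥({v}ᶜ : Set V), S.Nontrivial →
      2 ≤ ((Subtype.val '' S).toFinset).card := fun S hS => by
    refine Finset.one_lt_card_iff_nontrivial.2 ?_
    rw [Finset.Nontrivial, Set.coe_toFinset]
    exact hS.image Subtype.val_injective
  set X := (Subtype.val '' A).toFinset with hX
  set Y := (Subtype.val '' B).toFinset with hY
  have hXY : ∀ w ∈ X, w ∉ Y := fun w hw hw' => by
    obtain ⟨i, hi⟩ := (mem A w).1 hw
    obtain ⟨j, hj⟩ := (mem B w).1 hw'
    exact Set.disjoint_left.1 hdisj hi hj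
  have hall : ∀ w, w = v ∨ w ∈ X ∨ w ∈ Y := fun w => by
    by_cases hw : w = v
    · exact Or.inl hw
    · rcases (hcov.ge (Set.mem_univ ⟨w, hw⟩) : _ ∈ A ∪ B) with i | i
      · exact Or.inr (Or.inl ((mem A w).2 ⟨hw, i⟩))
      · exact Or.inr (Or.inr ((mem B w).2 ⟨hw, i⟩))
  have hsum : X.card + Y.card ≤ Fintype.card V := by
    rw [← Finset.card_union_of_disjoint (Finset.disjoint_left.2 fun w => hXY w)]
    exact Finset.card_le_univ _
  have hXc : 2 ≤ X.card := hcard A hA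
  have hYc : 2 ≤ Y.card := hcard B hB
  have hadj : ∀ x ∈ X, ∀ y ∈ Y, G.Adj x y ↔ x ∈ Subtype.val '' A' ∧ y ∈ Subtype.val '' B' := by
    intro x hx y hy
    obtain ⟨i, hi⟩ := (mem A x).1 hx
    obtain ⟨j, hj⟩ := (mem B y).1 hy
    have := hs _ hi _ hj
    simp only [SimpleGraph.deleteVertex, SimpleGraph.comap_adj, Function.Embedding.subtype_apply]
      at this
    rw [this]
    simp [i, j]
  obtain ⟨h1, h2⟩ := h.conn_le_of_split hL (v := v) (X := X) (hvmem A) hXc (by omega)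
    fun x hx y hyv hyX => hadj x hx y ((hall y).resolve_left hyv |>.resolve_left hyX)
  obtain ⟨h3, h4⟩ := h.conn_le_of_split hL (v := v) (X := Y) (A := Subtype.val '' B')
    (B := Subtype.val '' A') (hvmem B) hYc (by omega)
    fun x hx y hyv hyX => by
      rw [G.adj_comm, hadj y ((hall y).resolve_left hyv |>.resolve_right hyX) x hx, and_comm]
  exact ⟨X, Y, hvmem A, hvmem B, hXY, hall, hXc, hYc, h1, h3, h2, h4⟩

/-- Deletion has type `a = (0, 1)`. Local complementation at `v` turns the type at `v` into `a + b =
(1, 1)`, and a pivot on an edge at `v` turns it into `b = (1, 0)`. -/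
lemma twoBlocked_of_not_isNonEssential (hn : 4 ≤ Fintype.card V) (hG : G.IsPrime) {v : V}
    (hv : ¬ G.IsNonEssential v) : (ofGraph G).TwoBlocked v := by
  have hL := ofGraph_prime hG
  have hP := ofGraph_presents G
  have h1 : ¬ (G.deleteVertex v).IsPrime → (ofGraph G).Blocked v (0, 1) := fun h => hP.blocked hL h
  have h2 : ¬ ((G.localComplement v).deleteVertex v).IsPrime → (ofGraph G).Blocked v (1, 1) := by
    intro h
    have := (hP.localComplement v).blocked hL h
    rw [Function.update_self] at this
    simpa using this
  have h3 : ¬ G.PrimeContraction v → (ofGraph G).Blocked v (1, 0) := by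
    intro h
    unfold SimpleGraph.PrimeContraction at h
    push Not at h
    obtain ⟨H, hH | ⟨w, hvw, rfl⟩, hnp⟩ := h
    -- An isolated vertex is impossible: its row would be a nonzero member supported on one vertex.
    · have := hL.eq_zero_of_pair hn (hP.row_mem v) v v fun w hw _ => row_of_not_adj hw (hH.1 w)
      have h0 := congrFun this v
      rw [row_self] at h0
      simp at h0
    · obtain ⟨a', b', hP', e, -⟩ := hP.pivot hvw
      have := hP'.blocked hL hnp
      rwa [e] at this
  unfold SimpleGraph.IsNonEssential at hv
  by_cases i1 : (G.deleteVertex v).IsPrime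
  · have i2 := h2 fun i2 => hv (Or.inl ⟨i1, i2⟩)
    have i3 := h3 fun i3 => hv (Or.inr (Or.inl ⟨i1, i3⟩))
    exact ⟨(1, 1), (1, 0), by decide, by decide, by decide, i2, i3⟩
  · by_cases i2 : ((G.localComplement v).deleteVertex v).IsPrime
    · have i3 := h3 fun i3 => hv (Or.inr (Or.inr ⟨i2, i3⟩))
      exact ⟨(0, 1), (1, 0), by decide, by decide, by decide, h1 i1, i3⟩
    · exact ⟨(0, 1), (1, 1), by decide, by decide, by decide, h1 i1, h2 i2⟩

end Split

end IsotropicSystem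

/-! ### From a cyclic sequence of triples to a cycle graph -/

namespace IsotropicSystem
open SimpleGraph

variable {V : Type*} [Fintype V] {L : IsotropicSystem V} {m : ℕ}

lemma zmod_natCast_ne_zero {k : ℕ} (hk : 0 < k) (hkm : k < m + 5) : (k : ZMod (m + 5)) ≠ 0 := by
  rw [Ne, ZMod.natCast_eq_zero_iff]
  exact Nat.not_dvd_of_pos_of_lt hk hkm

lemma add_eq_zero_or_eq (x y z : Pauli) (hx : x ≠ 0) (hxy : x ≠ y) (hz : z ≠ 0) (hzy : z ≠ y)
    (hy : y ≠ 0) : x + z = 0 ∨ x + z = y := by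
  have key : ∀ x y z : Pauli, x = 0 ∨ x = y ∨ z = 0 ∨ z = y ∨ y = 0 ∨ x + z = 0 ∨ x + z = y := by
    decide
  have := key x y z
  tauto

section Cycle

variable {q : ZMod (m + 5) ≃ V} {T : ZMod (m + 5) → V → Pauli}

lemma cyclic_ne {i j : ZMod (m + 5)} (k : ℕ) (hk : 0 < k) (hk' : k < 5) (h : i - j = k) :
    q i ≠ q j := fun e => zmod_natCast_ne_zero hk (by omega)
  (by rw [← h, q.injective e, sub_self] : (k : ZMod (m + 5)) = 0)

/-- With at least five vertices on the cycle, the triples centred at `i - 1` and `i + 1` meet only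
in `q i`. -/
lemma cyclic_side (hT : ∀ i, L.IsTriple (T i) (q (i - 1)) (q i) (q (i + 1)))
    (i : ZMod (m + 5)) : T (i - 1) (q i) = T (i + 1) (q i) := by
  have h1 := (hT (i - 1)).reverse
  have h2 := hT (i + 1)
  rw [sub_add_cancel] at h1
  rw [add_sub_cancel_right] at h2
  refine h1.agree h2 (cyclic_ne 2 ?_ ?_ ?_).symm (cyclic_ne 3 ?_ ?_ ?_).symm
    (cyclic_ne 3 ?_ ?_ ?_).symm (cyclic_ne 4 ?_ ?_ ?_).symm
  all_goals first
    | omega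
    | (push_cast; ring)

variable [DecidableEq V]

lemma cyclic_mid_ne (hL : L.Prime) (hn : 4 ≤ Fintype.card V)
    (hT : ∀ i, L.IsTriple (T i) (q (i - 1)) (q i) (q (i + 1)))
    (i : ZMod (m + 5)) : T i (q i) ≠ T (i + 1) (q i) := by
  have h1 := (hT i).rotate
  have h2 := hT (i + 1)
  rw [add_sub_cancel_right] at h2
  refine h1.differ hL hn h2 (cyclic_ne 3 ?_ ?_ ?_).symm
  · omega
  · omega
  · push_cast; ring

/-- A graph presenting a prime system with a cyclic sequence of triples is locally equivalent to
a cycle. -/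
lemma Presents.locallyEquivalentToCycle (hL : L.Prime) (hn : 4 ≤ Fintype.card V)
    (hT : ∀ i, L.IsTriple (T i) (q (i - 1)) (q i) (q (i + 1))) {G : SimpleGraph V}
    {a b : V → Pauli} (hG : L.Presents G a b) : G.LocallyEquivalentToCycle := by
  set a' : V → Pauli := fun v => T (q.symm v + 1) v with ha'
  have a'_apply : ∀ i, a' (q i) = T (i + 1) (q i) := fun i => by simp [ha']
  -- Away from its centre, `T i` takes only the values 0 and `a'`, so it pairs with `r` only at `q
  -- i`. There `r` is 0 or `a'`, while `T i` has a different nonzero value, which forces `r (q i) =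
  -- 0`.
  have hE : ∀ r ∈ L.carrier, (∀ v, r v = 0 ∨ r v = a' v) → r = 0 := by
    intro r hr htype
    funext v
    obtain ⟨i, rfl⟩ := q.surjective v
    have h1 := L.isotropic r hr (T i) (hT i).mem
    rw [Finset.sum_eq_single (q i)] at h1
    · rcases htype (q i) with e | e
      · exact e
      · have := eq_zero_or_eq_of_symp _ _ (hT i).mid h1
        refine this.resolve_right fun e' => cyclic_mid_ne hL hn hT i ?_
        rw [← e', e, a'_apply]
    · intro w _ hw
      have key : T i w = 0 ∨ T i w = a' w := by
        by_cases hw1 : w = q (i - 1)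
        · right
          rw [hw1, a'_apply, sub_add_cancel]
        by_cases hw2 : w = q (i + 1)
        · right
          rw [hw2, a'_apply, ← cyclic_side hT, add_sub_cancel_right]
        · exact Or.inl ((hT i).zero w hw1 hw hw2)
      rcases key with e | e <;> rcases htype w with e' | e' <;>
        simp [e, e', symp_zero_left, symp_zero_right, symp_self]
    · simp
  obtain ⟨H, b', hGH, hH⟩ := hG.exists_locallyEquivalent (a' := a') (fun v => by
    obtain ⟨i, rfl⟩ := q.surjective v
    rw [a'_apply]
    have := (hT (i + 1)).fst
    rwa [add_sub_cancel_right] at this) hE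
  have hrow : ∀ i, row H a' b' (q i) = T i := by
    intro i
    -- At `q i` both summands are nonzero and different from `a'`, so their sum is 0 or `a'`;
    -- elsewhere both take only the values 0 and `a'`. By `hE` the sum vanishes.
    have h0 : row H a' b' (q i) + T i = 0 := by
      refine hE _ (L.carrier.add_mem (hH.row_mem _) (hT i).mem) fun w => ?_
      have key : ∀ x y : Pauli, (x = 0 ∨ x = y) → ∀ z, (z = 0 ∨ z = y) → x + z = 0 ∨ x + z = y := by
        decide
      by_cases hw : w = q i
      · subst hw
        rw [Pi.add_apply, row_self]
        refine add_eq_zero_or_eq _ _ _ (hH.ne_zero_right _) (hH.ne _).symm (hT i).mid ?_ (hH.ne_zero_left _)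
        rw [a'_apply]
        exact cyclic_mid_ne hL hn hT i
      · refine key _ _ (row_eq_zero_or hw) _ ?_
        by_cases hw1 : w = q (i - 1)
        · right
          rw [hw1, a'_apply, sub_add_cancel]
        by_cases hw2 : w = q (i + 1)
        · right
          rw [hw2, a'_apply, ← cyclic_side hT, add_sub_cancel_right]
        · exact Or.inl ((hT i).zero w hw1 hw hw2)
    funext w
    exact (add_eq_zero _ _).1 (congrFun h0 w)
  have hadj : ∀ i j, H.Adj (q i) (q j) ↔ i - j = 1 ∨ j - i = 1 := by
    intro i j
    by_cases hij : j = i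
    · subst hij
      have := zmod_natCast_ne_zero (m := m) (k := 1) (by omega) (by omega)
      rw [Nat.cast_one] at this
      simp [this.symm]
    have h1 : H.Adj (q i) (q j) ↔ T i (q j) ≠ 0 := by
      rw [← hrow i]
      constructor
      · intro h
        rw [row_of_adj h]
        exact hH.ne_zero_left _
      · intro h
        by_contra h'
        exact h (row_of_not_adj (fun e => hij (q.injective e)) h')
    rw [h1]
    constructor
    · intro h
      by_contra! h'
      refine h ((hT i).zero _ (fun e => h'.1 ?_) (fun e => hij (q.injective e)) fun e => h'.2 ?_)
      · rw [q.injective e]; ring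
      · rw [q.injective e]; ring
    · rintro (h | h)
      · obtain rfl : j = i - 1 := by rw [← h]; ring
        exact (hT i).fst
      · obtain rfl : j = i + 1 := by rw [← h]; ring
        exact (hT i).lst
  refine ⟨H, hGH, m + 5, by omega, ⟨RelIso.symm ⟨q, fun {i j} => ?_⟩⟩⟩
  exact (hadj i j).trans (cycleGraph_adj (n := m + 3) (u := i) (v := j)).symm

end Cycle

variable [DecidableEq V]

/-- Only the two triples across the ends of the chain are missing; they are the complements of the
intervals of length n - 3 starting at positions 1 and 2. -/
lemma IsChain.exists_cyclic (hL : L.Prime) (hV : Fintype.card V = m + 5) {p : ℕ → V}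
    (h : L.IsChain (Fintype.card V) p) : ∃ (q : ZMod (m + 5) ≃ V) (T : ZMod (m + 5) → V → Pauli),
      ∀ i, L.IsTriple (T i) (q (i - 1)) (q i) (q (i + 1)) := by
  have hval : ∀ i : ZMod (m + 5), i.val < Fintype.card V := fun i => by
    rw [hV]; exact ZMod.val_lt i
  let q : ZMod (m + 5) ≃ V := Equiv.ofBijective (fun i => p i.val)
    ((Fintype.bijective_iff_injective_and_card _).2
      ⟨fun i j e => ZMod.val_injective _ (h.inj _ (hval i) _ (hval j) e), by rw [ZMod.card, hV]⟩)
  have key : ∀ j : ZMod (m + 5), ∃ t, L.IsTriple t (q j) (q (j + 1)) (q (j + 1 + 1)) := by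
    intro j
    have hj := ZMod.val_lt j
    have v1 : (j + 1).val = (j.val + 1) % (m + 5) := by
      rw [ZMod.val_add, ZMod.val_one'' (by omega)]
    have v2 : (j + 1 + 1).val = ((j + 1).val + 1) % (m + 5) := by
      rw [ZMod.val_add, ZMod.val_one'' (by omega)]
    change ∃ t, L.IsTriple t (p j.val) (p (j + 1).val) (p (j + 1 + 1).val)
    rcases lt_trichotomy (j.val) (m + 3) with hlt | heq | hgt
    · rw [Nat.mod_eq_of_lt (by omega)] at v1
      rw [v1, Nat.mod_eq_of_lt (by omega)] at v2
      rw [v2, v1]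
      exact h.triple _ (by omega)
    · rw [Nat.mod_eq_of_lt (by omega)] at v1
      rw [v1, heq, Nat.mod_self] at v2
      rw [v2, v1, heq]
      exact h.exists_isTriple_compl hL (by omega) (i := 1) (by omega)
        (h.ne (by omega) (by omega) (by omega)) (h.ne (by omega) (by omega) (by omega))
        (h.ne (by omega) (by omega) (by omega))
        (h.notMem_interval (by omega) (by omega) (by omega))
        (h.notMem_interval (by omega) (by omega) (by omega))
        (h.notMem_interval (by omega) (by omega) (by omega))
    · have hj' : j.val = m + 4 := by omega
      rw [hj', Nat.mod_self] at v1
      rw [v1, Nat.mod_eq_of_lt (by omega)] at v2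
      rw [v2, v1, hj']
      exact h.exists_isTriple_compl hL (by omega) (i := 2) (by omega)
        (h.ne (by omega) (by omega) (by omega)) (h.ne (by omega) (by omega) (by omega))
        (h.ne (by omega) (by omega) (by omega))
        (h.notMem_interval (by omega) (by omega) (by omega))
        (h.notMem_interval (by omega) (by omega) (by omega))
        (h.notMem_interval (by omega) (by omega) (by omega))
  choose t ht using key
  refine ⟨q, fun i => t (i - 1), fun i => ?_⟩
  have := ht (i - 1)
  rwa [sub_add_cancel] at this

end IsotropicSystem

theorem theorem1 {V : Type*} [Finite V] (G : SimpleGraph V) (hcard : 5 ≤ Nat.card V)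
    (hprime : G.IsPrime) (hcycle : ¬ G.LocallyEquivalentToCycle) :
    2 ≤ {v : V | G.IsNonEssential v}.ncard := by
  classical
  have := Fintype.ofFinite V
  rw [Nat.card_eq_fintype_card] at hcard
  by_contra hlt
  have hL := IsotropicSystem.ofGraph_prime hprime
  -- Two vertices that are not twice blocked would be two non-essential vertices.
  have hB : ∀ u v, u ≠ v →
      (IsotropicSystem.ofGraph G).TwoBlocked u ∨ (IsotropicSystem.ofGraph G).TwoBlocked v := by
    intro u v huv
    by_contra! hne
    have hmem : ∀ w, ¬ (IsotropicSystem.ofGraph G).TwoBlocked w → G.IsNonEssential w := fun w hw =>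
      by_contra fun h =>
        hw (IsotropicSystem.twoBlocked_of_not_isNonEssential (by omega) hprime h)
    refine hlt ?_
    rw [← Set.ncard_pair huv]
    refine Set.ncard_le_ncard ?_ (Set.toFinite _)
    rintro w (rfl | rfl)
    · exact hmem _ hne.1
    · exact hmem _ hne.2
  obtain ⟨m, hm⟩ : ∃ m, Fintype.card V = m + 5 := ⟨Fintype.card V - 5, by omega⟩
  obtain ⟨p, hp⟩ := hL.exists_spanning_chain hcard hB
  obtain ⟨q, T, hT⟩ := hp.exists_cyclic hL hm
  exact hcycle ((IsotropicSystem.ofGraph_presents G).locallyEquivalentToCycle hL (by omega) hT)
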